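/- Let $K$ be an algebraically closed field and let $P(C):\ F-C\,G=0$ $(C\in K)$ be a pencil of cubic curves in the projective plane $\mathbb{P}^2(K)$, where $F,G$ are non-zero cubic forms without a common factor. The base-points of the pencil are the points of $F=G=0$. The multiplicity of a base-point is the multiplicity of that point on the general curve of the pencil, i.e. the minimum of its multiplicities on $F=0$ and $G=0$; a base-point is simple if it has multiplicity $1$ and double if it has multiplicity $2$. A curve $Q$ of degree $d$ (possibly reducible) is an involution curve for the pencil if the set of base-points is finite and, for all but finitely many $C\in K$, the sum over all base-points of the intersection numbers of $Q$ with $P(C)$ equals $3d-1$. Suppose that the pencil has five distinct base-points $b_0,b_1,b_2,b_3,b_4$, of which $b_0$ is double and $b_1,b_2,b_3,b_4$ are simple, and that all curves of the pencil are tangent at $b_1$ to one line $T$ through $b_1$ (where a curve that is singular at $b_1$ counts as tangent to $T$ at $b_1$). Let $Q$ be a curve for which $b_1$ is a simple point with tangent line $T$, and such that one of the following holds. (i) $Q$ has degree $2$, $b_0$ lies on $Q$, and $Q$ contains exactly one of the points $b_2,b_3,b_4$, which is a simple point of $Q$. (ii) $Q$ has degree $3$, $b_0$ is a double point of $Q$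 (multiplicity exactly $2$), and $Q$ contains exactly two of the points $b_2,b_3,b_4$, both of which are simple points of $Q$. Then $Q$ is an involution curve for the pencil. -/

import Mathlib

open scoped LinearAlgebra.Projectivization

noncomputable section

namespace PlanePencil

variable {K : Type*} [Field K]

/-- `F = 0` is a plane projective curve of degree `d` (possibly reducible or non-reduced). -/
def IsPlaneCurve (F : MvPolynomial (Fin 3) K) (d : ℕ) : Prop :=
  F ≠ 0 ∧ F.IsHomogeneous d

/-- The point `p` of the projective plane lies on the curve `F = 0`. -/
def OnCurve (F : MvPolynomial (Fin 3) K) (p : ℙ K (Fin 3 → K)) : Prop :=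
  MvPolynomial.eval p.rep F = 0

theorem exists_rep_ne_zero (p : ℙ K (Fin 3 → K)) : ∃ i, p.rep i ≠ 0 :=
  Function.ne_iff.mp p.rep_nonzero

/-- The index of a coordinate that does not vanish at `p`. -/
def chartIndex (p : ℙ K (Fin 3 → K)) : Fin 3 :=
  Classical.choose (exists_rep_ne_zero p)

/-- The equation of the curve `F = 0` in affine coordinates centred at `p`. With `v` a vector
representing `p` and `v i ≠ 0`, the affine chart is the plane `X i = v i`, and its two coordinates
are the remaining `X j - v j`. -/
def localEquation (F : MvPolynomial (Fin 3) K) (p : ℙ K (Fin 3 → K)) :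
    MvPolynomial (Fin 2) K :=
  MvPolynomial.aeval
    (Fin.insertNth (α := fun _ => MvPolynomial (Fin 2) K) (chartIndex p)
      (MvPolynomial.C (p.rep (chartIndex p)))
      (fun k => MvPolynomial.C (p.rep ((chartIndex p).succAbove k)) + MvPolynomial.X k)) F

/-- The multiplicity of `p` on the curve `F = 0`: the degree of the lowest non-zero homogeneous
part of the equation in affine coordinates centred at `p`. -/
def multiplicity (F : MvPolynomial (Fin 3) K) (p : ℙ K (Fin 3 → K)) : ℕ∞ :=
  MvPowerSeries.order (localEquation F p : MvPowerSeries (Fin 2) K)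

/-- The ideal of the origin of the affine plane. -/
abbrev originIdeal (K : Type*) [Field K] : Ideal (MvPolynomial (Fin 2) K) :=
  RingHom.ker (MvPolynomial.constantCoeff : MvPolynomial (Fin 2) K →+* K)

instance : (originIdeal K).IsPrime :=
  RingHom.ker_isPrime _

/-- The local ring of the affine plane at the origin. -/
abbrev OriginLocalRing (K : Type*) [Field K] : Type _ :=
  Localization.AtPrime (originIdeal K)

/-- The intersection number at `p` of the curves `F = 0` and `G = 0`: the dimension over `K` of the
local ring of the plane at `p` modulo the local equations of the two curves (the length of a
`K`-vector space is its dimension, with value `⊤` when that is infinite). -/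
def intersectionNumber (F G : MvPolynomial (Fin 3) K) (p : ℙ K (Fin 3 → K)) : ℕ∞ :=
  Module.length K
    (OriginLocalRing K ⧸
      (Ideal.span {algebraMap (MvPolynomial (Fin 2) K) (OriginLocalRing K) (localEquation F p),
        algebraMap (MvPolynomial (Fin 2) K) (OriginLocalRing K) (localEquation G p)} :
          Ideal (OriginLocalRing K)))

/-- The line `T = 0` is tangent at `p` to the curve `F = 0`: both pass through `p`, and in affine
coordinates centred at `p` the linear part of `F` is a multiple of that of `T`. At a simple point of
the curve this says that `T = 0` is the tangent line; at a singular point it holds for every line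
through `p`. -/
def IsTangentLine (T F : MvPolynomial (Fin 3) K) (p : ℙ K (Fin 3 → K)) : Prop :=
  OnCurve T p ∧ OnCurve F p ∧
    ∃ c : K, MvPolynomial.homogeneousComponent 1 (localEquation F p) =
      c • MvPolynomial.homogeneousComponent 1 (localEquation T p)

/-- `F` and `G` span a pencil of cubic curves (without a common component). -/
structure IsCubicPencil (F G : MvPolynomial (Fin 3) K) : Prop where
  left : IsPlaneCurve F 3
  right : IsPlaneCurve G 3
  relPrime : IsRelPrime F G

/-- The curve `F - c G = 0` of the pencil. -/
def pencilMember (F G : MvPolynomial (Fin 3) K) (c : K) : MvPolynomial (Fin 3) K :=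
  F - c • G

/-- The base-points of the pencil. -/
def basePoints (F G : MvPolynomial (Fin 3) K) : Set (ℙ K (Fin 3 → K)) :=
  {p | OnCurve F p ∧ OnCurve G p}

/-- The multiplicity of `p` as a base-point of the pencil: the least multiplicity of `p` on the
curves of the pencil, which is its multiplicity on all of them but at most one. -/
def baseMultiplicity (F G : MvPolynomial (Fin 3) K) (p : ℙ K (Fin 3 → K)) : ℕ∞ :=
  min (multiplicity F p) (multiplicity G p)

/-- The curve `Q = 0` is an involution curve for the cubic pencil `F - c G = 0`: for all but
finitely many curves of the pencil, the intersection numbers of `Q = 0` with the curve at the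
base-points of the pencil add up to `3 * deg Q - 1`. -/
def IsInvolutionCurve (F G Q : MvPolynomial (Fin 3) K) : Prop :=
  (basePoints F G).Finite ∧
    {c : K | (∑ᶠ p ∈ basePoints F G, intersectionNumber Q (pencilMember F G c) p) + 1
      ≠ 3 * (Q.totalDegree : ℕ∞)}.Finite

end PlanePencil

end

noncomputable section

namespace PlanePencil

open MvPolynomial Module Filter

/-! ### Powers of the ideal of the origin -/

section Origin

variable {K : Type*} [Field K]

/-! The heart is an elementary form of Bézout's inequality, `sum_finrank_quotient_le`: if at
finitely many distinct points ideals containing a power of the maximal ideal and the local equations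
of `F` and `G` are given, their colengths add up to at most 9. Indeed the forms of a large degree
surject onto the product of the local quotients (`exists_interpolation`), the multiples of `F` and
`G` go to zero, and by coprimality these have codimension at most 9
(`finrank_homogeneousSubmodule_le`).

Let `m` be the ideal of the origin and `q` the local equation of `Q`. The ideals `(F, G) + m ^ 3` at
`b 0`, `(q) + m ^ 2` at `b 1` and `m` at the other three points have colengths at least 4, 2, 1, 1,
1, which already add up to 9. Hence there is no further base-point, and no choice of ideals can do
better at any point. This excludes every degeneracy: the quadratic parts of `F` and `G` have no
common root at `b 0`; at `b 1`, once multiples of `q` have been subtracted to remove the linear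
parts, the quadratic parts do not both vanish along the tangent; at the other points the linear
parts have no common root.

A general member of the pencil then avoids the finitely many tangent directions of `Q`. So its
intersection number with `Q` is the product of the multiplicities at `b 0` and at the simple points
on `Q`, and 2 at `b 1`. The totals are 2 + 2 + 1 = 5 for the conic and 4 + 2 + 1 + 1 = 8 for the
cubic.

For the conic it remains to see that `b 0` is a simple point of it. Otherwise it contains the line
through `b 0` and `b 1`; correcting `F` and `G` by cubic multiples of `Q` gives cubics singular at
both points, which contain that line too. Then `F` and `G` vanish on the line, contrary to the
finiteness of the base-points (`homogeneousComponent_one_ne_zero`). -/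

theorem originIdeal_eq_idealOfVars : originIdeal K = idealOfVars (Fin 2) K := by
  ext p
  have := mem_pow_idealOfVars_iff' 1 p
  rw [pow_one] at this
  rw [this, RingHom.mem_ker, constantCoeff_eq]
  constructor
  · intro h x hx
    have : x = 0 := by
      rw [← Finsupp.degree_eq_zero_iff]
      omega
    rwa [this]
  · intro h
    exact h 0 (by simp)

theorem mem_originIdeal_pow_iff (n : ℕ) (p : MvPolynomial (Fin 2) K) :
    p ∈ originIdeal K ^ n ↔ ∀ x : Fin 2 →₀ ℕ, x.degree < n → p.coeff x = 0 := by
  rw [originIdeal_eq_idealOfVars, mem_pow_idealOfVars_iff']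

theorem mem_originIdeal_pow_of_isHomogeneous {p : MvPolynomial (Fin 2) K} {n : ℕ}
    (hp : p.IsHomogeneous n) : p ∈ originIdeal K ^ n := by
  rw [mem_originIdeal_pow_iff]
  intro x hx
  exact hp.coeff_eq_zero hx.ne

theorem sub_homogeneousComponent_mem {p : MvPolynomial (Fin 2) K} {n : ℕ}
    (hp : p ∈ originIdeal K ^ n) : p - homogeneousComponent n p ∈ originIdeal K ^ (n + 1) := by
  rw [mem_originIdeal_pow_iff] at *
  intro x hx
  rw [coeff_sub, coeff_homogeneousComponent]
  split_ifs with h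
  · simp
  · rw [hp x (by omega), sub_zero]

theorem homogeneousComponent_eq_zero_iff_mem {p : MvPolynomial (Fin 2) K} {n : ℕ}
    (hp : p ∈ originIdeal K ^ n) :
    homogeneousComponent n p = 0 ↔ p ∈ originIdeal K ^ (n + 1) := by
  constructor
  · intro h
    simpa [h] using sub_homogeneousComponent_mem hp
  · intro h
    rw [mem_originIdeal_pow_iff] at h
    ext x
    rw [coeff_homogeneousComponent]
    split_ifs with hx
    · rw [h x (by omega), coeff_zero]
    · simp

theorem homogeneousComponent_eq_zero_of_mem {p : MvPolynomial (Fin 2) K} {n : ℕ}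
    (h : p ∈ originIdeal K ^ (n + 1)) : homogeneousComponent n p = 0 :=
  (homogeneousComponent_eq_zero_iff_mem (Ideal.pow_le_pow_right n.le_succ h)).2 h

theorem mul_mem_originIdeal_pow {p q : MvPolynomial (Fin 2) K} {m n k : ℕ}
    (hp : p ∈ originIdeal K ^ m) (hq : q ∈ originIdeal K ^ n) (h : k ≤ m + n) :
    p * q ∈ originIdeal K ^ k :=
  Ideal.pow_le_pow_right h (pow_add (originIdeal K) m n ▸ Ideal.mul_mem_mul hp hq)

/-! ### Codimensions of ideals containing a power of the ideal of the origin -/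

/-- The exponents of total degree less than `N`, sorted by degree. -/
abbrev lowExponents (N : ℕ) : Finset (Σ _ : ℕ, Fin 2 →₀ ℕ) :=
  (Finset.range N).sigma fun n => Finset.finsuppAntidiag Finset.univ n

theorem mem_lowExponents {N : ℕ} {x : Σ _ : ℕ, Fin 2 →₀ ℕ} :
    x ∈ lowExponents N ↔ x.1 < N ∧ x.2.degree = x.1 := by
  simp [lowExponents, Finset.mem_finsuppAntidiag, Finsupp.degree_eq_sum]

theorem card_lowExponents (N : ℕ) :
    (lowExponents N).card = ∑ n ∈ Finset.range N, (n + 1) := by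
  rw [Finset.card_sigma]
  refine Finset.sum_congr rfl fun n _ => ?_
  rw [Finset.card_finsuppAntidiag_nat_eq_choose]
  simp [add_comm 1 n]

/-- The coefficients of a polynomial in degrees less than `N`. -/
def lowCoeffs (K : Type*) [Field K] (N : ℕ) :
    MvPolynomial (Fin 2) K →ₗ[K] (lowExponents N → K) :=
  LinearMap.pi fun x => lcoeff K x.1.2

theorem ker_lowCoeffs (N : ℕ) :
    LinearMap.ker (lowCoeffs K N) = (originIdeal K ^ N).restrictScalars K := by
  ext p
  rw [LinearMap.mem_ker, Submodule.restrictScalars_mem, mem_originIdeal_pow_iff]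
  constructor
  · intro h x hx
    exact congrFun h ⟨⟨x.degree, x⟩, mem_lowExponents.2 ⟨hx, rfl⟩⟩
  · intro h
    ext ⟨x, hx⟩
    rw [mem_lowExponents] at hx
    exact h x.2 (by omega)

theorem lowCoeffs_surjective (N : ℕ) : Function.Surjective (lowCoeffs K N) := by
  classical
  intro v
  refine ⟨∑ x : lowExponents N, monomial x.1.2 (v x), ?_⟩
  ext ⟨y, hy⟩
  simp only [lowCoeffs, LinearMap.pi_apply, lcoeff_apply, coeff_sum, coeff_monomial]
  rw [Finset.sum_eq_single ⟨y, hy⟩]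
  · simp
  · rintro ⟨x, hx⟩ - hxy
    rw [if_neg]
    rintro h
    apply hxy
    rw [mem_lowExponents] at hx hy
    have h1 : x.1 = y.1 := by rw [← hx.2, ← hy.2, h]
    apply Subtype.ext
    exact Sigma.ext h1 (heq_of_eq h)
  · simp

/-- The quotient by an ideal containing a power of the ideal of the origin, in terms of
coefficients. -/
theorem finrank_quotient_add_finrank_map {J : Ideal (MvPolynomial (Fin 2) K)} {N : ℕ}
    (hJ : originIdeal K ^ N ≤ J) :
    Module.Finite K (MvPolynomial (Fin 2) K ⧸ J) ∧
    finrank K (MvPolynomial (Fin 2) K ⧸ J) +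
      finrank K ((J.restrictScalars K).map (lowCoeffs K N)) = ∑ n ∈ Finset.range N, (n + 1) := by
  set S := (J.restrictScalars K).map (lowCoeffs K N) with hS
  -- Since `J` contains the kernel of `lowCoeffs`, it is determined by its low coefficients, so the
  -- two quotients agree.
  have hcomap : S.comap (lowCoeffs K N) = J.restrictScalars K := by
    rw [hS, Submodule.comap_map_eq, ker_lowCoeffs, sup_eq_left]
    exact hJ
  let φ : MvPolynomial (Fin 2) K →ₗ[K] ((lowExponents N → K) ⧸ S) := S.mkQ ∘ₗ lowCoeffs K N
  have hφ : Function.Surjective φ := (Submodule.mkQ_surjective S).comp (lowCoeffs_surjective N)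
  have hker : LinearMap.ker φ = J.restrictScalars K := by
    rw [LinearMap.ker_comp, Submodule.ker_mkQ, hcomap]
  let e : (MvPolynomial (Fin 2) K ⧸ J) ≃ₗ[K] ((lowExponents N → K) ⧸ S) :=
    (Submodule.Quotient.restrictScalarsEquiv K J).symm ≪≫ₗ
      (Submodule.quotEquivOfEq _ _ hker.symm) ≪≫ₗ φ.quotKerEquivOfSurjective hφ
  refine ⟨Module.Finite.equiv e.symm, ?_⟩
  rw [e.finrank_eq, Submodule.finrank_quotient_add_finrank, finrank_fintype_fun_eq_card,
    Fintype.card_coe, card_lowExponents]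

/-- There are 1 + 2 + ... + `N` monomials of degree less than `N`, and `k` elements spanning `J`
modulo the `N`-th power impose at most `k` relations on them. All lower bounds for local
contributions come from this count. -/
theorem le_finrank_quotient {J : Ideal (MvPolynomial (Fin 2) K)} {N k : ℕ}
    (hJ : originIdeal K ^ N ≤ J) (w : Fin k → MvPolynomial (Fin 2) K)
    (hw : J.restrictScalars K ≤
      (originIdeal K ^ N).restrictScalars K ⊔ Submodule.span K (Set.range w)) :
    ∑ n ∈ Finset.range N, (n + 1) ≤ finrank K (MvPolynomial (Fin 2) K ⧸ J) + k := by
  rw [← (finrank_quotient_add_finrank_map hJ).2]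
  refine Nat.add_le_add_left ?_ _
  have h : (J.restrictScalars K).map (lowCoeffs K N) ≤
      Submodule.span K (Set.range (lowCoeffs K N ∘ w)) := by
    refine (Submodule.map_mono hw).trans ?_
    rw [Submodule.map_sup, ← ker_lowCoeffs, Submodule.map_span, ← Set.range_comp, sup_le_iff]
    refine ⟨?_, le_rfl⟩
    rintro _ ⟨x, hx, rfl⟩
    rw [LinearMap.mem_ker.1 hx]
    exact zero_mem _
  refine (Submodule.finrank_mono h).trans ?_
  exact (finrank_range_le_card (R := K) (lowCoeffs K N ∘ w)).trans_eq (Fintype.card_fin k)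

theorem finrank_quotient_add_eq {J : Ideal (MvPolynomial (Fin 2) K)} {N k : ℕ}
    (hJ : originIdeal K ^ N ≤ J) (w : Fin k → MvPolynomial (Fin 2) K)
    (hw : J.restrictScalars K ≤
      (originIdeal K ^ N).restrictScalars K ⊔ Submodule.span K (Set.range w))
    (hwJ : ∀ i, w i ∈ J)
    (hind : ∀ c : Fin k → K, ∑ i, c i • w i ∈ originIdeal K ^ N → ∀ i, c i = 0) :
    finrank K (MvPolynomial (Fin 2) K ⧸ J) + k = ∑ n ∈ Finset.range N, (n + 1) := by
  refine le_antisymm ?_ (le_finrank_quotient hJ w hw)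
  rw [← (finrank_quotient_add_finrank_map hJ).2]
  refine Nat.add_le_add_left ?_ _
  have hli : LinearIndependent K (lowCoeffs K N ∘ w) := by
    rw [Fintype.linearIndependent_iff]
    intro c hc
    apply hind c
    rw [← Submodule.restrictScalars_mem K, ← ker_lowCoeffs, LinearMap.mem_ker, map_sum]
    simpa using hc
  have h : Submodule.span K (Set.range (lowCoeffs K N ∘ w)) ≤
      (J.restrictScalars K).map (lowCoeffs K N) := by
    rw [Submodule.span_le]
    rintro _ ⟨i, rfl⟩
    exact ⟨w i, hwJ i, rfl⟩
  simpa [finrank_span_eq_card hli] using Submodule.finrank_mono h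

/-! ### The local ring at the origin -/

/-- After scaling, `s` is 1 minus an element of the ideal of the origin, so the truncated geometric
series inverts it modulo the `N`-th power. -/
theorem exists_mul_sub_one_mem {J : Ideal (MvPolynomial (Fin 2) K)} {N : ℕ}
    (hJ : originIdeal K ^ N ≤ J) {s : MvPolynomial (Fin 2) K} (hs : s ∉ originIdeal K) :
    ∃ t, t * s - 1 ∈ J := by
  have hs0 : constantCoeff s ≠ 0 := hs
  have hw : 1 - C (constantCoeff s)⁻¹ * s ∈ originIdeal K := by
    rw [RingHom.mem_ker]
    simp [hs0]
  have h := mul_neg_geom_sum (1 - C (constantCoeff s)⁻¹ * s) N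
  refine ⟨C (constantCoeff s)⁻¹ * ∑ i ∈ Finset.range N, (1 - C (constantCoeff s)⁻¹ * s) ^ i, ?_⟩
  have h2 : C (constantCoeff s)⁻¹ * (∑ i ∈ Finset.range N,
      (1 - C (constantCoeff s)⁻¹ * s) ^ i) * s - 1 =
      -(1 - C (constantCoeff s)⁻¹ * s) ^ N := by
    linear_combination h
  rw [h2]
  exact neg_mem (hJ (Ideal.pow_mem_pow hw N))

/-- The length of the quotient of the local ring by an ideal containing a power of the maximal
ideal is computed in the polynomial ring. -/
theorem length_quotient_map {J : Ideal (MvPolynomial (Fin 2) K)} {N : ℕ}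
    (hJ : originIdeal K ^ N ≤ J) :
    Module.length K
      (OriginLocalRing K ⧸ J.map (algebraMap (MvPolynomial (Fin 2) K) (OriginLocalRing K))) =
      finrank K (MvPolynomial (Fin 2) K ⧸ J) := by
  let ψ : MvPolynomial (Fin 2) K →ₐ[K]
      (OriginLocalRing K ⧸ J.map (algebraMap (MvPolynomial (Fin 2) K) (OriginLocalRing K))) :=
    (Ideal.Quotient.mkₐ K _).comp
      (IsScalarTower.toAlgHom K (MvPolynomial (Fin 2) K) (OriginLocalRing K))
  have hψ : ∀ a, ψ a = Ideal.Quotient.mk _ (algebraMap _ (OriginLocalRing K) a) := fun a => rfl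
  have hsurj : Function.Surjective ψ := by
    intro y
    obtain ⟨z, rfl⟩ := Ideal.Quotient.mk_surjective y
    obtain ⟨a, s, rfl⟩ := IsLocalization.exists_mk'_eq (originIdeal K).primeCompl z
    obtain ⟨t, ht⟩ := exists_mul_sub_one_mem hJ s.2
    refine ⟨t * a, ?_⟩
    rw [hψ, Ideal.Quotient.eq]
    have : algebraMap _ (OriginLocalRing K) (t * a) -
        IsLocalization.mk' (OriginLocalRing K) a s =
        algebraMap _ (OriginLocalRing K) (t * s - 1) *
          IsLocalization.mk' (OriginLocalRing K) a s := by
      rw [map_sub, map_mul, map_mul, map_one, sub_mul, mul_assoc, IsLocalization.mk'_spec', one_mul]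
    rw [this]
    exact Ideal.mul_mem_right _ _ (Ideal.mem_map_of_mem _ ht)
  have hker : RingHom.ker ψ = J := by
    ext a
    rw [RingHom.mem_ker, hψ, Ideal.Quotient.eq_zero_iff_mem,
      IsLocalization.algebraMap_mem_map_algebraMap_iff (originIdeal K).primeCompl]
    constructor
    · rintro ⟨s, hs, h⟩
      obtain ⟨t, ht⟩ := exists_mul_sub_one_mem hJ hs
      have : a = t * (s * a) - a * (t * s - 1) := by ring
      rw [this]
      exact sub_mem (Ideal.mul_mem_left _ _ h) (Ideal.mul_mem_left _ _ ht)
    · intro h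
      exact ⟨1, one_mem _, by simpa using h⟩
  let e := (Ideal.quotientEquivAlgOfEq K hker.symm).trans
    (Ideal.quotientKerAlgEquivOfSurjective hsurj)
  have := (finrank_quotient_add_finrank_map hJ).1
  rw [← e.toLinearEquiv.length_eq, Module.length_eq_finrank]

/-- In the local ring the hypothesis puts `m ^ N` inside `(q, p) + m * m ^ N`, so by Nakayama `m ^
N` lies in `(q, p)`. Adding `m ^ N` therefore changes nothing, and the length becomes a count of
coefficients. -/
theorem length_quotient_span_pair {q p : MvPolynomial (Fin 2) K} {N : ℕ}
    (h : originIdeal K ^ N ≤ Ideal.span {q, p} ⊔ originIdeal K ^ (N + 1)) :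
    Module.length K (OriginLocalRing K ⧸
      (Ideal.span {algebraMap (MvPolynomial (Fin 2) K) (OriginLocalRing K) q,
        algebraMap (MvPolynomial (Fin 2) K) (OriginLocalRing K) p} :
          Ideal (OriginLocalRing K))) =
      finrank K (MvPolynomial (Fin 2) K ⧸ (Ideal.span {q, p} ⊔ originIdeal K ^ N)) := by
  rw [← length_quotient_map (N := N) le_sup_right, Ideal.map_sup]
  have hspan : (Ideal.span {algebraMap (MvPolynomial (Fin 2) K) (OriginLocalRing K) q,
        algebraMap (MvPolynomial (Fin 2) K) (OriginLocalRing K) p} :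
          Ideal (OriginLocalRing K)) =
      (Ideal.span {q, p}).map (algebraMap (MvPolynomial (Fin 2) K) (OriginLocalRing K)) := by
    rw [Ideal.map_span, Set.image_pair]
  rw [hspan, sup_eq_left.2]
  have h2 := Ideal.map_mono (f := algebraMap (MvPolynomial (Fin 2) K) (OriginLocalRing K)) h
  rw [Ideal.map_sup, pow_succ', Ideal.map_mul] at h2
  refine Submodule.le_of_le_smul_of_le_jacobson_bot
    (I := (originIdeal K).map (algebraMap (MvPolynomial (Fin 2) K) (OriginLocalRing K)))
    (IsNoetherian.noetherian _) ?_ h2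
  rw [IsLocalRing.jacobson_eq_maximalIdeal _ bot_ne_top]
  exact (IsLocalization.AtPrime.map_eq_maximalIdeal (originIdeal K) (OriginLocalRing K)).le

end Origin

/-! ### Homogeneous polynomials -/

section Homogeneous

variable {K σ : Type*} [Field K]

theorem homogeneousComponent_mul_of_isHomogeneous {p : MvPolynomial σ K} {m : ℕ}
    (hp : p.IsHomogeneous m) (n : ℕ) (q : MvPolynomial σ K) :
    homogeneousComponent (m + n) (p * q) = p * homogeneousComponent n q := by
  have h (i : ℕ) : homogeneousComponent (m + n) (p * homogeneousComponent i q) =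
      if n = i then p * homogeneousComponent i q else 0 := by
    rw [homogeneousComponent_of_mem (hp.mul (homogeneousComponent_isHomogeneous i q))]
    simp
  conv_lhs => rw [← sum_homogeneousComponent q, Finset.mul_sum, map_sum]
  simp only [h]
  rw [Finset.sum_ite_eq]
  split_ifs with hn
  · rfl
  · rw [homogeneousComponent_eq_zero _ _ (by simpa using hn), mul_zero]

theorem aeval_mul_of_isHomogeneous {A : Type*} [CommRing A] [Algebra K A] {p : MvPolynomial σ K}
    {m : ℕ} (hp : p.IsHomogeneous m) (c : A) (x : σ → A) :
    aeval (fun i => c * x i) p = c ^ m * aeval x p := by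
  rw [aeval_def, aeval_def, eval₂_eq, eval₂_eq, Finset.mul_sum]
  refine Finset.sum_congr rfl fun d hd => ?_
  simp only [mul_pow]
  rw [Finset.prod_mul_distrib, Finset.prod_pow_eq_pow_sum, ← hp.degree_eq_sum_deg_support hd]
  ring

theorem eval_smul_of_isHomogeneous {p : MvPolynomial σ K}
    {m : ℕ} (hp : p.IsHomogeneous m) (c : K) (x : σ → K) :
    eval (c • x) p = c ^ m * eval x p := by
  have := aeval_mul_of_isHomogeneous hp c x
  rwa [aeval_eq_eval] at this

end Homogeneous

/-! ### Binary forms -/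

section BinaryForms

variable {K : Type*} [Field K]

theorem exists_eq_X_mul_add {h : MvPolynomial (Fin 2) K} {n : ℕ} (hh : h.IsHomogeneous (n + 1)) :
    ∃ a b : MvPolynomial (Fin 2) K, a.IsHomogeneous n ∧ b.IsHomogeneous n ∧
      h = X 0 * a + X 1 * b := by
  have hm : h ∈ originIdeal K := by
    have := mem_originIdeal_pow_of_isHomogeneous hh
    exact Ideal.pow_le_self n.succ_ne_zero this
  rw [originIdeal_eq_idealOfVars] at hm
  have hr : Set.range (X : Fin 2 → MvPolynomial (Fin 2) K) = {X 0, X 1} := by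
    ext; simp [Fin.exists_fin_two, eq_comm]
  rw [idealOfVars, hr, Ideal.mem_span_pair] at hm
  obtain ⟨a, b, hab⟩ := hm
  refine ⟨homogeneousComponent n a, homogeneousComponent n b,
    homogeneousComponent_isHomogeneous n a, homogeneousComponent_isHomogeneous n b, ?_⟩
  rw [← homogeneousComponent_eq_self hh, ← hab, map_add, mul_comm a, mul_comm b,
    add_comm n 1, homogeneousComponent_mul_of_isHomogeneous (isHomogeneous_X K 0),
    homogeneousComponent_mul_of_isHomogeneous (isHomogeneous_X K 1)]

/-- The linear form vanishing at the point `(P 0 : P 1)` of the projective line. -/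
def pointForm (P : Fin 2 → K) : MvPolynomial (Fin 2) K :=
  C (P 1) * X 0 - C (P 0) * X 1

theorem pointForm_isHomogeneous (P : Fin 2 → K) : (pointForm P).IsHomogeneous 1 :=
  (isHomogeneous_C_mul_X _ _).sub (isHomogeneous_C_mul_X _ _)

theorem exists_eq_of_isHomogeneous_one {h : MvPolynomial (Fin 2) K} (hh : h.IsHomogeneous 1) :
    ∃ a b : K, h = C a * X 0 + C b * X 1 := by
  obtain ⟨f, g, hf, hg, rfl⟩ := exists_eq_X_mul_add (n := 0) hh
  rw [← mem_homogeneousSubmodule, homogeneousSubmodule_zero] at hf hg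
  obtain ⟨a, rfl⟩ := Submodule.mem_one.1 hf
  obtain ⟨b, rfl⟩ := Submodule.mem_one.1 hg
  exact ⟨a, b, by simp only [algebraMap_eq]; ring⟩

theorem exists_eq_of_isHomogeneous_two {h : MvPolynomial (Fin 2) K} (hh : h.IsHomogeneous 2) :
    ∃ a b c : K, h = C a * X 0 ^ 2 + C b * (X 0 * X 1) + C c * X 1 ^ 2 := by
  obtain ⟨f, g, hf, hg, rfl⟩ := exists_eq_X_mul_add (n := 1) hh
  obtain ⟨a, b, rfl⟩ := exists_eq_of_isHomogeneous_one hf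
  obtain ⟨c, d, rfl⟩ := exists_eq_of_isHomogeneous_one hg
  exact ⟨a, b + c, d, by simp only [C_add]; ring⟩

theorem exists_eq_of_isHomogeneous_three {h : MvPolynomial (Fin 2) K} (hh : h.IsHomogeneous 3) :
    ∃ a b c d : K, h = C a * X 0 ^ 3 + C b * (X 0 ^ 2 * X 1) + C c * (X 0 * X 1 ^ 2) +
      C d * X 1 ^ 3 := by
  obtain ⟨f, g, hf, hg, rfl⟩ := exists_eq_X_mul_add (n := 2) hh
  obtain ⟨a, b, c, rfl⟩ := exists_eq_of_isHomogeneous_two hf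
  obtain ⟨a', b', c', rfl⟩ := exists_eq_of_isHomogeneous_two hg
  exact ⟨a, b + a', c + b', c', by simp only [C_add]; ring⟩

theorem exists_eq_pointForm {h : MvPolynomial (Fin 2) K} (hh : h.IsHomogeneous 1) (h0 : h ≠ 0) :
    ∃ P : Fin 2 → K, P ≠ 0 ∧ h = pointForm P := by
  obtain ⟨a, b, rfl⟩ := exists_eq_of_isHomogeneous_one hh
  refine ⟨![-b, a], ?_, by simp [pointForm]⟩
  rintro hP
  apply h0
  have h1 := congrFun hP 0
  have h2 := congrFun hP 1
  simp at h1 h2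
  simp [h1, h2]

/-- Modulo the linear form, both variables are multiples of one class `y` with coefficients `P 0`
and `P 1`. By homogeneity `h` becomes `y ^ (n + 1) * h(P)`, which is zero; the cofactor is then
replaced by its part of degree `n`. -/
theorem exists_eq_pointForm_mul {h : MvPolynomial (Fin 2) K} {n : ℕ}
    (hh : h.IsHomogeneous (n + 1)) {P : Fin 2 → K} (hP : P ≠ 0) (h0 : eval P h = 0) :
    ∃ k : MvPolynomial (Fin 2) K, k.IsHomogeneous n ∧ h = pointForm P * k := by
  suffices hd : h ∈ Ideal.span {pointForm P} by
    obtain ⟨k, hk⟩ := Ideal.mem_span_singleton'.1 hd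
    refine ⟨homogeneousComponent n k, homogeneousComponent_isHomogeneous n k, ?_⟩
    rw [← homogeneousComponent_mul_of_isHomogeneous (pointForm_isHomogeneous P), mul_comm, hk,
      add_comm 1 n, homogeneousComponent_eq_self hh]
  set π := Ideal.Quotient.mkₐ K (Ideal.span {pointForm P})
  have hrel : C (P 1) * X 0 - C (P 0) * X 1 ∈ Ideal.span {pointForm P} :=
    Ideal.mem_span_singleton_self _
  -- a coordinate function on the line through the origin
  obtain ⟨y, hy⟩ : ∃ y : MvPolynomial (Fin 2) K, ∀ i, π (X i) = π (y * C (P i)) := by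
    have hrel' : π (C (P 1) * X 0) = π (C (P 0) * X 1) :=
      (Ideal.Quotient.mk_eq_mk_iff_sub_mem _ _).2 hrel
    by_cases h1 : P 1 = 0
    · have h2 : P 0 ≠ 0 := fun h2 => hP (by ext i; fin_cases i <;> simpa)
      refine ⟨C (P 0)⁻¹ * X 0, fun i => ?_⟩
      have hc : (C (P 0)⁻¹ * C (P 0) : MvPolynomial (Fin 2) K) = 1 := by rw [← C_mul]; simp [h2]
      fin_cases i
      · exact congrArg π (by simp only [Fin.zero_eta]; linear_combination (- X 0) * hc)
      · have : π (C (P 0)⁻¹ * X 0 * C (P 1)) = π (C (P 0)⁻¹) * π (C (P 1) * X 0) := by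
          rw [← map_mul]; exact congrArg π (by ring)
        simp only [Fin.mk_one]
        rw [this, hrel', ← map_mul]
        exact congrArg π (by linear_combination (- X 1) * hc)
    · refine ⟨C (P 1)⁻¹ * X 1, fun i => ?_⟩
      have hc : (C (P 1)⁻¹ * C (P 1) : MvPolynomial (Fin 2) K) = 1 := by rw [← C_mul]; simp [h1]
      fin_cases i
      · have : π (C (P 1)⁻¹ * X 1 * C (P 0)) = π (C (P 1)⁻¹) * π (C (P 0) * X 1) := by
          rw [← map_mul]; exact congrArg π (by ring)
        simp only [Fin.zero_eta]
        rw [this, ← hrel', ← map_mul]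
        exact congrArg π (by linear_combination (- X 0) * hc)
      · exact congrArg π (by simp only [Fin.mk_one]; linear_combination (- X 1) * hc)
  rw [← Ideal.Quotient.eq_zero_iff_mem]
  change π h = 0
  have h1 : π h = aeval (fun i => π y * algebraMap K _ (P i)) h := by
    have h2 : π = aeval (fun i => π (X i)) := by
      ext i
      simp
    rw [h2]
    congr 2
    rw [← h2]
    ext i
    rw [hy i, map_mul, ← algebraMap_eq, AlgHom.commutes]
  rw [h1, aeval_mul_of_isHomogeneous hh]
  have h3 : aeval (fun i => algebraMap K (MvPolynomial (Fin 2) K ⧸ Ideal.span {pointForm P}) (P i))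
      h = algebraMap K _ (eval P h) := by
    have := aeval_algebraMap_apply (MvPolynomial (Fin 2) K ⧸ Ideal.span {pointForm P}) P h
    rwa [aeval_eq_eval] at this
  rw [h3, h0, map_zero, mul_zero]

@[simp]
theorem eval_pointForm_self (P : Fin 2 → K) : eval P (pointForm P) = 0 := by
  simp [pointForm, mul_comm]

theorem pointForm_ne_zero {P : Fin 2 → K} (hP : P ≠ 0) : pointForm P ≠ 0 := by
  intro h
  have h0 := congrArg (eval ![1, 0]) h
  have h1 := congrArg (eval ![0, 1]) h
  simp [pointForm] at h0 h1
  exact hP (by ext i; fin_cases i <;> simpa)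

theorem exists_eval_eq_zero [IsAlgClosed K] {h : MvPolynomial (Fin 2) K} (hh : h.IsHomogeneous 2) :
    ∃ P : Fin 2 → K, P ≠ 0 ∧ eval P h = 0 := by
  obtain ⟨a, b, c, rfl⟩ := exists_eq_of_isHomogeneous_two hh
  by_cases ha : a = 0
  · exact ⟨![1, 0], by simp, by simp [ha]⟩
  · obtain ⟨t, ht⟩ := IsAlgClosed.exists_root
      (Polynomial.C a * Polynomial.X ^ 2 + Polynomial.C b * Polynomial.X + Polynomial.C c)
      (by rw [Polynomial.degree_quadratic ha]; decide)
    refine ⟨![t, 1], by simp, ?_⟩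
    simpa using ht

theorem exists_eq_pointForm_mul_pointForm [IsAlgClosed K] {h : MvPolynomial (Fin 2) K}
    (hh : h.IsHomogeneous 2) (h0 : h ≠ 0) :
    ∃ P R : Fin 2 → K, P ≠ 0 ∧ R ≠ 0 ∧ h = pointForm P * pointForm R := by
  obtain ⟨P, hP, hP0⟩ := exists_eval_eq_zero hh
  obtain ⟨k, hk, rfl⟩ := exists_eq_pointForm_mul (n := 1) hh hP hP0
  obtain ⟨R, hR, rfl⟩ := exists_eq_pointForm hk (right_ne_zero_of_mul h0)
  exact ⟨P, R, hP, hR, rfl⟩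

/-- A linear form and a form not vanishing at its root generate all forms of large degree. -/
theorem exists_eq_mul_pointForm_add {P : Fin 2 → K} (hP : P ≠ 0) {p h : MvPolynomial (Fin 2) K}
    {s n : ℕ} (hp : p.IsHomogeneous (s + 1)) (hpP : eval P p ≠ 0)
    (hh : h.IsHomogeneous (n + (s + 1))) :
    ∃ a b : MvPolynomial (Fin 2) K, a.IsHomogeneous (n + s) ∧ b.IsHomogeneous n ∧
      h = a * pointForm P + b * p := by
  obtain ⟨i, hi⟩ : ∃ i, P i ≠ 0 := Function.ne_iff.1 hP
  set b : MvPolynomial (Fin 2) K := C (eval P h / (eval P p * P i ^ n)) * X i ^ n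
  have hb : b.IsHomogeneous n := isHomogeneous_C_mul_X_pow _ _ _
  obtain ⟨a, ha, hab⟩ := exists_eq_pointForm_mul (n := n + s) (h := h - b * p)
    (hh.sub (hb.mul hp)) hP (by simp [b]; field_simp; simp)
  exact ⟨a, b, ha, hb, by linear_combination hab⟩

/-- Division by one linear factor, then of the quotient by the other; `P` and `R` may coincide, as
for a cusp. -/
theorem exists_eq_mul_pointForm_mul_add {P R : Fin 2 → K} (hP : P ≠ 0) (hR : R ≠ 0)
    {p h : MvPolynomial (Fin 2) K} {s : ℕ} (hp : p.IsHomogeneous (s + 1)) (hpP : eval P p ≠ 0)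
    (hpR : eval R p ≠ 0) (hh : h.IsHomogeneous (s + 2)) :
    ∃ a b : MvPolynomial (Fin 2) K, a.IsHomogeneous s ∧ b.IsHomogeneous 1 ∧
      h = a * (pointForm P * pointForm R) + b * p := by
  obtain ⟨a, b, ha, hb, rfl⟩ := exists_eq_mul_pointForm_add (n := 1) hP hp hpP
    (by rwa [show 1 + (s + 1) = s + 2 by ring])
  obtain ⟨a', b', ha', hb', rfl⟩ := exists_eq_mul_pointForm_add (n := 0) hR hp hpR
    (by rwa [show 0 + (s + 1) = 1 + s by ring])
  rw [zero_add] at ha'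
  refine ⟨a', b' * pointForm P + b, ha', ?_, by ring⟩
  exact (hb'.mul (pointForm_isHomogeneous P)).add hb

end BinaryForms

/-! ### Local intersection numbers -/

section LocalIntersection

variable {K : Type*} [Field K]

/-- The length of the local ring at the origin modulo two polynomials. -/
def localLength (q p : MvPolynomial (Fin 2) K) : ℕ∞ :=
  Module.length K (OriginLocalRing K ⧸
      (Ideal.span {algebraMap (MvPolynomial (Fin 2) K) (OriginLocalRing K) q,
        algebraMap (MvPolynomial (Fin 2) K) (OriginLocalRing K) p} :
          Ideal (OriginLocalRing K)))

/-- It suffices to generate the forms of degree `N` by the leading forms of `q` and `p`: replacing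
these by `q` and `p` introduces errors of order at least `N + 1` only. This supplies the hypothesis
of `length_quotient_span_pair`. -/
theorem originIdeal_pow_le {q p : MvPolynomial (Fin 2) K} {r s i j N : ℕ}
    (hq : q ∈ originIdeal K ^ r) (hp : p ∈ originIdeal K ^ s) (hi : i + r = N) (hj : j + s = N)
    (H : ∀ h : MvPolynomial (Fin 2) K, h.IsHomogeneous N → ∃ a b : MvPolynomial (Fin 2) K,
      a.IsHomogeneous i ∧ b.IsHomogeneous j ∧
        h = a * homogeneousComponent r q + b * homogeneousComponent s p) :
    originIdeal K ^ N ≤ Ideal.span {q, p} ⊔ originIdeal K ^ (N + 1) := by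
  intro f hf
  obtain ⟨a, b, ha, hb, hab⟩ := H _ (homogeneousComponent_isHomogeneous N f)
  refine Submodule.mem_sup.2 ⟨a * q + b * p, Ideal.mem_span_pair.2 ⟨a, b, rfl⟩,
    (f - homogeneousComponent N f) - a * (q - homogeneousComponent r q) -
      b * (p - homogeneousComponent s p), ?_, by linear_combination -hab⟩
  refine sub_mem (sub_mem (sub_homogeneousComponent_mem hf) ?_) ?_
  · exact mul_mem_originIdeal_pow (mem_originIdeal_pow_of_isHomogeneous ha)
      (sub_homogeneousComponent_mem hq) (by omega)
  · exact mul_mem_originIdeal_pow (mem_originIdeal_pow_of_isHomogeneous hb)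
      (sub_homogeneousComponent_mem hp) (by omega)

theorem mul_sub_smul_mem {f : MvPolynomial (Fin 2) K} {n : ℕ} (hf : f ∈ originIdeal K ^ n)
    (a : MvPolynomial (Fin 2) K) : a * f - constantCoeff a • f ∈ originIdeal K ^ (n + 1) := by
  have h : a - C (constantCoeff a) ∈ originIdeal K ^ 1 := by
    rw [pow_one, RingHom.mem_ker]
    simp
  have := mul_mem_originIdeal_pow h hf (add_comm n 1).le
  rwa [sub_mul, ← smul_eq_C_mul] at this

theorem localLength_eq_zero {q : MvPolynomial (Fin 2) K} (hq : q ∉ originIdeal K)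
    (p : MvPolynomial (Fin 2) K) : localLength q p = 0 := by
  rw [localLength, Module.length_eq_zero_iff, Ideal.Quotient.subsingleton_iff,
    Ideal.eq_top_iff_one]
  have hu : IsUnit (algebraMap (MvPolynomial (Fin 2) K) (OriginLocalRing K) q) :=
    IsLocalization.map_units (OriginLocalRing K) (⟨q, hq⟩ : (originIdeal K).primeCompl)
  rw [← Ideal.eq_top_iff_one]
  exact Ideal.eq_top_of_isUnit_mem _ (Ideal.subset_span (by simp)) hu

theorem localLength_eq_one {q p : MvPolynomial (Fin 2) K} (hq : q ∈ originIdeal K ^ 1)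
    (hp : p ∈ originIdeal K ^ 1) {P : Fin 2 → K} (hP : P ≠ 0)
    (hqP : homogeneousComponent 1 q = pointForm P) (hpP : eval P (homogeneousComponent 1 p) ≠ 0) :
    localLength q p = 1 := by
  have hN : originIdeal K ^ 1 ≤ Ideal.span {q, p} ⊔ originIdeal K ^ 2 :=
    originIdeal_pow_le (i := 0) (j := 0) hq hp rfl rfl fun h hh => by
      rw [hqP]
      exact exists_eq_mul_pointForm_add (n := 0) hP
        (homogeneousComponent_isHomogeneous 1 p) hpP hh
  have h := finrank_quotient_add_eq (J := Ideal.span {q, p} ⊔ originIdeal K ^ 1) (N := 1) (k := 0)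
    le_sup_right Fin.elim0 (le_sup_of_le_left (show Ideal.span {q, p} ⊔ originIdeal K ^ 1 ≤
      originIdeal K ^ 1 from sup_le (Ideal.span_le.2 (Set.pair_subset hq hp)) le_rfl))
    (fun i => i.elim0) (fun _ _ i => i.elim0)
  rw [localLength, length_quotient_span_pair hN]
  simpa using h

/-- The leading forms generate all forms of degree 2. Of the three monomials 1, `X 0`, `X 1` of
lower degree, `q` removes one dimension, and `p` none. -/
theorem localLength_eq_two {q p : MvPolynomial (Fin 2) K} (hq : q ∈ originIdeal K ^ 1)
    (hp : p ∈ originIdeal K ^ 2) {P : Fin 2 → K} (hP : P ≠ 0)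
    (hqP : homogeneousComponent 1 q = pointForm P) (hpP : eval P (homogeneousComponent 2 p) ≠ 0) :
    localLength q p = 2 := by
  have hN : originIdeal K ^ 2 ≤ Ideal.span {q, p} ⊔ originIdeal K ^ 3 :=
    originIdeal_pow_le (i := 1) (j := 0) hq hp rfl rfl fun h hh => by
      rw [hqP]
      exact exists_eq_mul_pointForm_add (n := 0) hP
        (homogeneousComponent_isHomogeneous 2 p) hpP hh
  have h := finrank_quotient_add_eq (J := Ideal.span {q, p} ⊔ originIdeal K ^ 2) (N := 2) (k := 1)
    le_sup_right ![q] ?_ ?_ ?_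
  · rw [localLength, length_quotient_span_pair hN]
    simp [Finset.sum_range_succ] at h
    rw [h]
    rfl
  · intro x hx
    obtain ⟨y, hy, z, hz, rfl⟩ := Submodule.mem_sup.1 hx
    obtain ⟨a, b, rfl⟩ := Ideal.mem_span_pair.1 hy
    refine Submodule.mem_sup.2 ⟨(a * q - constantCoeff a • q) + b * p + z, ?_,
      constantCoeff a • q, Submodule.smul_mem _ _ (Submodule.subset_span (by simp)), by ring⟩
    exact add_mem (add_mem (mul_sub_smul_mem hq a) (Ideal.mul_mem_left _ _ hp)) hz
  · intro i
    fin_cases i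
    exact Ideal.mem_sup_left (Ideal.subset_span (by simp))
  · intro c hc
    have h0 := homogeneousComponent_eq_zero_of_mem hc
    simp [hqP, pointForm_ne_zero hP] at h0
    intro i
    fin_cases i
    exact h0

/-- The leading forms generate all forms of degree 3, and among the six dimensions in degree less
than 3 the independent elements `q` and `p` remove two. -/
theorem localLength_eq_four {q p : MvPolynomial (Fin 2) K} (hq : q ∈ originIdeal K ^ 2)
    (hp : p ∈ originIdeal K ^ 2) {P R : Fin 2 → K} (hP : P ≠ 0) (hR : R ≠ 0)
    (hqPR : homogeneousComponent 2 q = pointForm P * pointForm R)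
    (hpP : eval P (homogeneousComponent 2 p) ≠ 0) (hpR : eval R (homogeneousComponent 2 p) ≠ 0) :
    localLength q p = 4 := by
  have hN : originIdeal K ^ 3 ≤ Ideal.span {q, p} ⊔ originIdeal K ^ 4 :=
    originIdeal_pow_le (i := 1) (j := 1) hq hp rfl rfl fun h hh => by
      rw [hqPR]
      exact exists_eq_mul_pointForm_mul_add hP hR
        (homogeneousComponent_isHomogeneous 2 p) hpP hpR hh
  have h := finrank_quotient_add_eq (J := Ideal.span {q, p} ⊔ originIdeal K ^ 3) (N := 3) (k := 2)
    le_sup_right ![q, p] ?_ ?_ ?_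
  · rw [localLength, length_quotient_span_pair hN]
    have h4 : finrank K (MvPolynomial (Fin 2) K ⧸ (Ideal.span {q, p} ⊔ originIdeal K ^ 3)) = 4 := by
      simp [Finset.sum_range_succ] at h
      exact h
    rw [h4]
    rfl
  · intro x hx
    obtain ⟨y, hy, z, hz, rfl⟩ := Submodule.mem_sup.1 hx
    obtain ⟨a, b, rfl⟩ := Ideal.mem_span_pair.1 hy
    refine Submodule.mem_sup.2 ⟨(a * q - constantCoeff a • q) + (b * p - constantCoeff b • p) + z,
      ?_, constantCoeff a • q + constantCoeff b • p, add_mem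
        (Submodule.smul_mem _ _ (Submodule.subset_span (by simp)))
        (Submodule.smul_mem _ _ (Submodule.subset_span (by simp))), by ring⟩
    exact add_mem (add_mem (mul_sub_smul_mem hq a) (mul_sub_smul_mem hp b)) hz
  · intro i
    fin_cases i
    · exact Ideal.mem_sup_left (Ideal.subset_span (by simp))
    · exact Ideal.mem_sup_left (Ideal.subset_span (by simp))
  · intro c hc
    have h0 := homogeneousComponent_eq_zero_of_mem hc
    simp only [Fin.sum_univ_two, map_add, map_smul, Matrix.cons_val_zero, Matrix.cons_val_one,
      hqPR] at h0
    -- Evaluation at `P` kills the leading form of `q` but not that of `p`.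
    have h1 : c 1 = 0 := by
      have := congrArg (eval P) h0
      simpa [smul_eval, hpP] using this
    have h2 : c 0 = 0 := by
      simpa [h1, pointForm_ne_zero hP, pointForm_ne_zero hR] using h0
    intro i
    fin_cases i
    · exact h2
    · exact h1

/-! ### Lower bounds for local lengths -/

theorem one_le_finrank_quotient :
    1 ≤ finrank K (MvPolynomial (Fin 2) K ⧸ originIdeal K ^ 1) := by
  simpa using le_finrank_quotient (J := originIdeal K ^ 1) (k := 0) le_rfl Fin.elim0 le_sup_left

theorem two_le_finrank_quotient {q : MvPolynomial (Fin 2) K} (hq : q ∈ originIdeal K ^ 1) :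
    2 ≤ finrank K (MvPolynomial (Fin 2) K ⧸ (Ideal.span {q} ⊔ originIdeal K ^ 2)) := by
  have h := le_finrank_quotient (J := Ideal.span {q} ⊔ originIdeal K ^ 2) (k := 1) le_sup_right
    ![q] ?_
  · simpa [Finset.sum_range_succ] using h
  · intro x hx
    obtain ⟨y, hy, z, hz, rfl⟩ := Submodule.mem_sup.1 hx
    obtain ⟨a, rfl⟩ := Ideal.mem_span_singleton'.1 hy
    exact Submodule.mem_sup.2 ⟨(a * q - constantCoeff a • q) + z,
      add_mem (mul_sub_smul_mem hq a) hz,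
      constantCoeff a • q, Submodule.smul_mem _ _ (Submodule.subset_span (by simp)), by ring⟩

theorem exists_eq_add_mem (a : MvPolynomial (Fin 2) K) :
    ∃ c d e : K, a - C c - C d * X 0 - C e * X 1 ∈ originIdeal K ^ 2 := by
  have h : a - C (constantCoeff a) ∈ originIdeal K ^ 1 := by
    rw [pow_one, RingHom.mem_ker]
    simp
  have h2 := sub_homogeneousComponent_mem h
  obtain ⟨d, e, hde⟩ := exists_eq_of_isHomogeneous_one
    (homogeneousComponent_isHomogeneous 1 (a - C (constantCoeff a)))
  rw [hde] at h2
  exact ⟨constantCoeff a, d, e, by rwa [sub_sub (a - _)]⟩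

theorem three_le_finrank_quotient {q : MvPolynomial (Fin 2) K} (hq : q ∈ originIdeal K ^ 1) :
    3 ≤ finrank K (MvPolynomial (Fin 2) K ⧸ (Ideal.span {q} ⊔ originIdeal K ^ 3)) := by
  have h := le_finrank_quotient (J := Ideal.span {q} ⊔ originIdeal K ^ 3) (k := 3) le_sup_right
    ![q, X 0 * q, X 1 * q] ?_
  · simpa [Finset.sum_range_succ] using h
  · intro x hx
    obtain ⟨y, hy, z, hz, rfl⟩ := Submodule.mem_sup.1 hx
    obtain ⟨a, rfl⟩ := Ideal.mem_span_singleton'.1 hy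
    obtain ⟨c, d, e, ha⟩ := exists_eq_add_mem a
    refine Submodule.mem_sup.2 ⟨(a - C c - C d * X 0 - C e * X 1) * q + z,
      add_mem (mul_mem_originIdeal_pow ha hq le_rfl) hz,
      c • q + d • (X 0 * q) + e • (X 1 * q), add_mem (add_mem
      (Submodule.smul_mem _ _ (Submodule.subset_span (by simp)))
      (Submodule.smul_mem _ _ (Submodule.subset_span (by simp))))
      (Submodule.smul_mem _ _ (Submodule.subset_span (by simp))), ?_⟩
    simp only [smul_eq_C_mul]
    ring

theorem four_le_finrank_quotient {f g : MvPolynomial (Fin 2) K} (hf : f ∈ originIdeal K ^ 2)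
    (hg : g ∈ originIdeal K ^ 2) :
    4 ≤ finrank K (MvPolynomial (Fin 2) K ⧸ (Ideal.span {f, g} ⊔ originIdeal K ^ 3)) := by
  have h := le_finrank_quotient (J := Ideal.span {f, g} ⊔ originIdeal K ^ 3) (k := 2) le_sup_right
    ![f, g] ?_
  · simpa [Finset.sum_range_succ] using h
  · intro x hx
    obtain ⟨y, hy, z, hz, rfl⟩ := Submodule.mem_sup.1 hx
    obtain ⟨a, b, rfl⟩ := Ideal.mem_span_pair.1 hy
    exact Submodule.mem_sup.2 ⟨(a * f - constantCoeff a • f) + (b * g - constantCoeff b • g) + z,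
      add_mem (add_mem (mul_sub_smul_mem hf a) (mul_sub_smul_mem hg b)) hz,
      constantCoeff a • f + constantCoeff b • g, add_mem
        (Submodule.smul_mem _ _ (Submodule.subset_span (by simp)))
        (Submodule.smul_mem _ _ (Submodule.subset_span (by simp))), by ring⟩

/-- Two polynomials of order at least two whose quadratic parts have a common root. -/
theorem five_le_finrank_quotient {f g : MvPolynomial (Fin 2) K} (hf : f ∈ originIdeal K ^ 2)
    (hg : g ∈ originIdeal K ^ 2) {P : Fin 2 → K} (hP : P ≠ 0)
    (hfP : eval P (homogeneousComponent 2 f) = 0) (hgP : eval P (homogeneousComponent 2 g) = 0) :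
    5 ≤ finrank K (MvPolynomial (Fin 2) K ⧸ (Ideal.span {f, g} ⊔ originIdeal K ^ 4)) := by
  -- There are ten monomials of degree less than 4. Both quadratic parts are divisible by the form
  -- of `P`, so in degree 3 the ideal yields only multiples of that form, a space of dimension
  -- three; with `f` and `g` this makes five.
  have h := le_finrank_quotient (J := Ideal.span {f, g} ⊔ originIdeal K ^ 4) (k := 5) le_sup_right
    ![f, g, pointForm P * X 0 ^ 2, pointForm P * (X 0 * X 1), pointForm P * X 1 ^ 2] ?_
  · simpa [Finset.sum_range_succ] using h
  · set w : Fin 5 → MvPolynomial (Fin 2) K :=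
      ![f, g, pointForm P * X 0 ^ 2, pointForm P * (X 0 * X 1), pointForm P * X 1 ^ 2]
    have key : ∀ k ∈ originIdeal K ^ 2, eval P (homogeneousComponent 2 k) = 0 →
        k ∈ Set.range w → ∀ a, a * k ∈ (originIdeal K ^ 4).restrictScalars K ⊔
          Submodule.span K (Set.range w) := by
      intro k hk hkP hkw a
      obtain ⟨u, hu, hku⟩ := exists_eq_pointForm_mul (n := 1)
        (homogeneousComponent_isHomogeneous 2 k) hP hkP
      obtain ⟨c, d, e, ha⟩ := exists_eq_add_mem a
      have hl : (C d * X 0 + C e * X 1 : MvPolynomial (Fin 2) K).IsHomogeneous 1 :=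
        (isHomogeneous_C_mul_X _ _).add (isHomogeneous_C_mul_X _ _)
      obtain ⟨a', b', c', hm⟩ := exists_eq_of_isHomogeneous_two (hl.mul hu)
      refine Submodule.mem_sup.2 ⟨(a - C c - C d * X 0 - C e * X 1) * k +
        (C d * X 0 + C e * X 1) * (k - homogeneousComponent 2 k),
        add_mem (mul_mem_originIdeal_pow ha hk le_rfl) (mul_mem_originIdeal_pow
          (mem_originIdeal_pow_of_isHomogeneous hl) (sub_homogeneousComponent_mem hk) le_rfl),
        c • k + (a' • w 2 + b' • w 3 + c' • w 4), ?_, ?_⟩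
      · exact add_mem (Submodule.smul_mem _ _ (Submodule.subset_span hkw)) (add_mem (add_mem
          (Submodule.smul_mem _ _ (Submodule.subset_span ⟨_, rfl⟩))
          (Submodule.smul_mem _ _ (Submodule.subset_span ⟨_, rfl⟩)))
          (Submodule.smul_mem _ _ (Submodule.subset_span ⟨_, rfl⟩)))
      · have : w 2 = pointForm P * X 0 ^ 2 := rfl
        rw [this]
        have : w 3 = pointForm P * (X 0 * X 1) := rfl
        rw [this]
        have : w 4 = pointForm P * X 1 ^ 2 := rfl
        rw [this, hku]
        simp only [smul_eq_C_mul]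
        linear_combination (- pointForm P) * hm
    intro x hx
    obtain ⟨y, hy, z, hz, rfl⟩ := Submodule.mem_sup.1 hx
    obtain ⟨a, b, rfl⟩ := Ideal.mem_span_pair.1 hy
    exact add_mem (add_mem (key f hf hfP ⟨0, rfl⟩ a) (key g hg hgP ⟨1, rfl⟩ b))
      (Submodule.mem_sup_left hz)

end LocalIntersection

/-! ### Dimensions of spaces of ternary forms -/

section Forms

variable {K : Type*} [Field K]

/-- A ternary form is given by its coefficients. -/
def formEquiv (K : Type*) [Field K] (d : ℕ) :
    homogeneousSubmodule (Fin 3) K d ≃ₗ[K]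
      ((Finset.finsuppAntidiag (Finset.univ : Finset (Fin 3)) d) → K) :=
  LinearEquiv.ofBijective
    (LinearMap.pi fun x => lcoeff K x.1 ∘ₗ (homogeneousSubmodule (Fin 3) K d).subtype) <| by
  classical
  have hmem (x : Fin 3 →₀ ℕ) :
      x ∈ Finset.finsuppAntidiag (Finset.univ : Finset (Fin 3)) d ↔ x.degree = d := by
    simp [Finset.mem_finsuppAntidiag, Finsupp.degree_eq_sum]
  constructor
  · rw [← LinearMap.ker_eq_bot, LinearMap.ker_eq_bot']
    rintro ⟨p, hp⟩ h
    ext x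
    by_cases hx : x.degree = d
    · exact congrFun h ⟨x, (hmem x).2 hx⟩
    · exact ((mem_homogeneousSubmodule d p).1 hp).coeff_eq_zero hx
  · intro v
    refine ⟨⟨∑ x, monomial x.1 (v x), sum_mem fun x _ =>
      isHomogeneous_monomial _ ((hmem x.1).1 x.2)⟩, ?_⟩
    ext x
    simp only [LinearMap.pi_apply, LinearMap.comp_apply, Submodule.subtype_apply, lcoeff_apply,
      coeff_sum, coeff_monomial]
    rw [Finset.sum_eq_single x]
    · simp
    · intro y _ hy
      rw [if_neg fun h => hy (Subtype.ext h)]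
    · simp

instance (d : ℕ) : Module.Finite K (homogeneousSubmodule (Fin 3) K d) :=
  Module.Finite.equiv (formEquiv K d).symm

theorem two_mul_finrank_homogeneousSubmodule (d : ℕ) :
    2 * finrank K (homogeneousSubmodule (Fin 3) K d) = (d + 2) * (d + 1) := by
  rw [(formEquiv K d).finrank_eq, finrank_fintype_fun_eq_card, Fintype.card_coe,
    Finset.card_finsuppAntidiag_nat_eq_choose]
  have h : (Finset.univ : Finset (Fin 3)).card + d - 1 = d + 2 := by
    simp
    omega
  rw [h, Nat.choose_symm_add, Nat.choose_two_right]
  exact Nat.mul_div_cancel' (Nat.even_mul_pred_self (d + 2)).two_dvd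

/-- The forms of degree `n + 3` in the ideal generated by two cubic forms. -/
def syzygyMap {F G : MvPolynomial (Fin 3) K} (hF : F.IsHomogeneous 3) (hG : G.IsHomogeneous 3)
    (n : ℕ) : homogeneousSubmodule (Fin 3) K n × homogeneousSubmodule (Fin 3) K n →ₗ[K]
      homogeneousSubmodule (Fin 3) K (n + 3) :=
  LinearMap.codRestrict _
    ((LinearMap.mulRight K F ∘ₗ (homogeneousSubmodule (Fin 3) K n).subtype).coprod
      (LinearMap.mulRight K G ∘ₗ (homogeneousSubmodule (Fin 3) K n).subtype))
    fun x => by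
      exact add_mem (((mem_homogeneousSubmodule _ _).1 x.1.2).mul hF)
        (((mem_homogeneousSubmodule _ _).1 x.2.2).mul hG)

theorem coe_syzygyMap {F G : MvPolynomial (Fin 3) K} (hF : F.IsHomogeneous 3)
    (hG : G.IsHomogeneous 3) (n : ℕ)
    (x : homogeneousSubmodule (Fin 3) K n × homogeneousSubmodule (Fin 3) K n) :
    (syzygyMap hF hG n x : MvPolynomial (Fin 3) K) = x.1 * F + x.2 * G :=
  rfl

/-- As `F` and `G` are coprime, `a * F + b * G = 0` forces `(a, b) = (c * G, -c * F)`: only Koszul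
syzygies occur, parametrised by `c` of degree `n`. -/
theorem finrank_ker_syzygyMap_le {F G : MvPolynomial (Fin 3) K} (h : IsCubicPencil F G) (n : ℕ) :
    finrank K (LinearMap.ker (syzygyMap h.left.2 h.right.2 (n + 3))) ≤
      finrank K (homogeneousSubmodule (Fin 3) K n) := by
  let χ : homogeneousSubmodule (Fin 3) K n →ₗ[K]
      homogeneousSubmodule (Fin 3) K (n + 3) × homogeneousSubmodule (Fin 3) K (n + 3) :=
    (LinearMap.codRestrict _
      (LinearMap.mulRight K G ∘ₗ (homogeneousSubmodule (Fin 3) K n).subtype)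
        fun x => ((mem_homogeneousSubmodule _ _).1 x.2).mul h.right.2).prod
    (-LinearMap.codRestrict _
      (LinearMap.mulRight K F ∘ₗ (homogeneousSubmodule (Fin 3) K n).subtype)
        fun x => ((mem_homogeneousSubmodule _ _).1 x.2).mul h.left.2)
  refine (Submodule.finrank_mono (t := LinearMap.range χ) ?_).trans (LinearMap.finrank_range_le χ)
  rintro ⟨⟨a, ha⟩, ⟨b, hb⟩⟩ hab
  have hab' : a * F + b * G = 0 := congrArg Subtype.val hab
  have hdvd : G ∣ a := h.relPrime.symm.dvd_of_dvd_mul_right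
    ⟨-b, by linear_combination hab'⟩
  obtain ⟨c, hc⟩ := hdvd
  have hc' : a = G * homogeneousComponent n c := by
    rw [← homogeneousComponent_mul_of_isHomogeneous h.right.2, ← hc, add_comm 3 n,
      homogeneousComponent_eq_self ((mem_homogeneousSubmodule _ _).1 ha)]
  have hb' : b = -(homogeneousComponent n c * F) := by
    apply mul_right_cancel₀ h.right.1
    rw [hc'] at hab'
    linear_combination hab'
  refine ⟨⟨homogeneousComponent n c, homogeneousComponent_isHomogeneous n c⟩, ?_⟩
  refine Prod.ext (Subtype.ext ?_) (Subtype.ext ?_)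
  · exact (mul_comm _ _).trans hc'.symm
  · exact hb'.symm

/-- With `s d` the dimension of the forms of degree `d`, one has `s (n + 6) - 2 * s (n + 3) + s n =
9`, the product of the two degrees. -/
theorem finrank_homogeneousSubmodule_le {F G : MvPolynomial (Fin 3) K} (h : IsCubicPencil F G)
    (n : ℕ) :
    finrank K (homogeneousSubmodule (Fin 3) K (n + 3 + 3)) ≤
      finrank K (LinearMap.range (syzygyMap h.left.2 h.right.2 (n + 3))) + 9 := by
  have h1 := LinearMap.finrank_range_add_finrank_ker (syzygyMap h.left.2 h.right.2 (n + 3))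
  have h2 := finrank_ker_syzygyMap_le h n
  rw [finrank_prod] at h1
  have h3 := two_mul_finrank_homogeneousSubmodule (K := K) n
  have h4 := two_mul_finrank_homogeneousSubmodule (K := K) (n + 3)
  have h5 := two_mul_finrank_homogeneousSubmodule (K := K) (n + 3 + 3)
  ring_nf at *
  omega

end Forms

/-! ### Local equations -/

section LocalEquation

variable {K : Type*} [Field K]

/-- Passage to affine coordinates centred at `p`. -/
def localHom (p : ℙ K (Fin 3 → K)) : MvPolynomial (Fin 3) K →ₐ[K] MvPolynomial (Fin 2) K :=
  aeval (Fin.insertNth (α := fun _ => MvPolynomial (Fin 2) K) (chartIndex p)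
      (C (p.rep (chartIndex p)))
      (fun k => C (p.rep ((chartIndex p).succAbove k)) + X k))

theorem localEquation_eq (F : MvPolynomial (Fin 3) K) (p : ℙ K (Fin 3 → K)) :
    localEquation F p = localHom p F :=
  rfl

theorem rep_chartIndex_ne_zero (p : ℙ K (Fin 3 → K)) : p.rep (chartIndex p) ≠ 0 :=
  Classical.choose_spec (exists_rep_ne_zero p)

theorem localHom_X_chartIndex (p : ℙ K (Fin 3 → K)) :
    localHom p (X (chartIndex p)) = C (p.rep (chartIndex p)) := by
  simp [localHom]

theorem localHom_X_succAbove (p : ℙ K (Fin 3 → K)) (k : Fin 2) :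
    localHom p (X ((chartIndex p).succAbove k)) =
      C (p.rep ((chartIndex p).succAbove k)) + X k := by
  simp [localHom]

theorem localHom_C (p : ℙ K (Fin 3 → K)) (c : K) : localHom p (C c) = C c := by
  simp [localHom]

theorem constantCoeff_localHom (p : ℙ K (Fin 3 → K)) (F : MvPolynomial (Fin 3) K) :
    constantCoeff (localHom p F) = eval p.rep F := by
  have h : (constantCoeff : MvPolynomial (Fin 2) K →+* K).comp (localHom p : _ →+* _) =
      eval p.rep := by
    ext i
    · simp
    · refine Fin.succAboveCases (chartIndex p) ?_ (fun k => ?_) i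
      · simp [localHom_X_chartIndex]
      · simp [localHom_X_succAbove]
  exact congrArg (fun f : MvPolynomial (Fin 3) K →+* K => f F) h

theorem onCurve_iff {F : MvPolynomial (Fin 3) K} {p : ℙ K (Fin 3 → K)} :
    OnCurve F p ↔ localHom p F ∈ originIdeal K ^ 1 := by
  rw [pow_one, RingHom.mem_ker, constantCoeff_localHom]
  rfl

theorem le_multiplicity_iff {F : MvPolynomial (Fin 3) K} {p : ℙ K (Fin 3 → K)} {n : ℕ} :
    (n : ℕ∞) ≤ multiplicity F p ↔ localHom p F ∈ originIdeal K ^ n := by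
  rw [mem_originIdeal_pow_iff, multiplicity, localEquation_eq]
  constructor
  · intro h x hx
    rw [← coeff_coe]
    exact MvPowerSeries.coeff_of_lt_order (lt_of_lt_of_le (by exact_mod_cast hx) h)
  · intro h
    refine MvPowerSeries.nat_le_order fun x hx => ?_
    rw [coeff_coe]
    exact h x hx

theorem multiplicity_eq_iff {F : MvPolynomial (Fin 3) K} {p : ℙ K (Fin 3 → K)} {n : ℕ} :
    multiplicity F p = n ↔
      localHom p F ∈ originIdeal K ^ n ∧ homogeneousComponent n (localHom p F) ≠ 0 := by
  constructor
  · intro h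
    have h1 := le_multiplicity_iff.1 h.ge
    refine ⟨h1, fun h2 => ?_⟩
    rw [homogeneousComponent_eq_zero_iff_mem h1, ← le_multiplicity_iff, h] at h2
    exact absurd h2 (by exact_mod_cast n.lt_succ_self.not_ge)
  · rintro ⟨h1, h2⟩
    rw [Ne, homogeneousComponent_eq_zero_iff_mem h1, ← le_multiplicity_iff, not_le] at h2
    refine le_antisymm (Order.le_of_lt_add_one ?_) (le_multiplicity_iff.2 h1)
    exact_mod_cast h2

theorem intersectionNumber_eq (F G : MvPolynomial (Fin 3) K) (p : ℙ K (Fin 3 → K)) :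
    intersectionNumber F G p = localLength (localHom p F) (localHom p G) :=
  rfl

/-- The linear form with value one on the affine chart at `p`. -/
def chartForm (p : ℙ K (Fin 3 → K)) : MvPolynomial (Fin 3) K :=
  C (p.rep (chartIndex p))⁻¹ * X (chartIndex p)

theorem chartForm_isHomogeneous (p : ℙ K (Fin 3 → K)) : (chartForm p).IsHomogeneous 1 :=
  isHomogeneous_C_mul_X _ _

@[simp]
theorem localHom_chartForm (p : ℙ K (Fin 3 → K)) : localHom p (chartForm p) = 1 := by
  rw [chartForm, map_mul, localHom_C, localHom_X_chartIndex, ← C_mul,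
    inv_mul_cancel₀ (rep_chartIndex_ne_zero p), C_1]

theorem exists_localHom_eq_X (p : ℙ K (Fin 3 → K)) (k : Fin 2) :
    ∃ L : MvPolynomial (Fin 3) K, L.IsHomogeneous 1 ∧ localHom p L = X k := by
  refine ⟨X ((chartIndex p).succAbove k) - C (p.rep ((chartIndex p).succAbove k)) * chartForm p,
    (isHomogeneous_X _ _).sub ((chartForm_isHomogeneous p).C_mul _), ?_⟩
  rw [map_sub, map_mul, localHom_chartForm, localHom_C, localHom_X_succAbove]
  ring

/-- Monomials of degree less than `N` are homogenised with powers of `chartForm p`, whose local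
equation is 1; the others may be replaced by zero. -/
theorem exists_localHom_sub_mem (p : ℙ K (Fin 3 → K)) {N d : ℕ} (hd : N ≤ d)
    (f : MvPolynomial (Fin 2) K) :
    ∃ H : MvPolynomial (Fin 3) K, H.IsHomogeneous d ∧ localHom p H - f ∈ originIdeal K ^ N := by
  induction f using MvPolynomial.induction_on' with
  | add f g hf hg =>
    obtain ⟨A, hA, hA'⟩ := hf
    obtain ⟨B, hB, hB'⟩ := hg
    refine ⟨A + B, hA.add hB, ?_⟩
    rw [map_add, add_sub_add_comm]
    exact add_mem hA' hB'
  | monomial e c =>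
    by_cases he : e.degree < N
    · choose L hL hLX using exists_localHom_eq_X p
      refine ⟨C c * (∏ k, L k ^ e k) * chartForm p ^ (d - e.degree), ?_, ?_⟩
      · have h1 : (∏ k, L k ^ e k).IsHomogeneous e.degree := by
          have := IsHomogeneous.prod Finset.univ (fun k => L k ^ e k) (fun k => 1 * e k)
            (fun k _ => (hL k).pow (e k))
          simpa [Finsupp.degree_eq_sum] using this
        have h2 := (h1.C_mul c).mul ((chartForm_isHomogeneous p).pow (d - e.degree))
        rwa [one_mul, Nat.add_sub_cancel' (by omega)] at h2
      · rw [map_mul, map_mul, map_pow, localHom_chartForm, one_pow, mul_one, localHom_C, map_prod,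
          monomial_eq, Finsupp.prod_fintype _ _ (by simp)]
        simp [hLX]
    · refine ⟨0, isHomogeneous_zero _ _ _, ?_⟩
      rw [map_zero, zero_sub]
      refine neg_mem ?_
      rw [mem_originIdeal_pow_iff]
      intro x hx
      rw [coeff_monomial, if_neg]
      rintro rfl
      exact he hx

theorem exists_linear_form {p q : ℙ K (Fin 3 → K)} (hpq : p ≠ q) :
    ∃ L : MvPolynomial (Fin 3) K, L.IsHomogeneous 1 ∧ eval q.rep L = 0 ∧ eval p.rep L ≠ 0 := by
  set i := chartIndex p
  have hi : p.rep i ≠ 0 := rep_chartIndex_ne_zero p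
  obtain ⟨j, hj⟩ : ∃ j, q.rep i * p.rep j - q.rep j * p.rep i ≠ 0 := by
    by_contra! h
    apply hpq
    rw [← p.mk_rep, ← q.mk_rep, eq_comm, Projectivization.mk_eq_mk_iff']
    refine ⟨q.rep i / p.rep i, ?_⟩
    ext j
    simp only [Pi.smul_apply, smul_eq_mul]
    field_simp
    linear_combination h j
  refine ⟨C (q.rep i) * X j - C (q.rep j) * X i,
    (isHomogeneous_C_mul_X _ _).sub (isHomogeneous_C_mul_X _ _), ?_, ?_⟩
  · simp [mul_comm]
  · simpa using hj

/-- Forms of large degree interpolate prescribed jets at finitely many points. -/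
theorem exists_interpolation {n : ℕ} {b : Fin n → ℙ K (Fin 3 → K)} (hb : Function.Injective b)
    (N k : ℕ) (i : Fin n) (f : MvPolynomial (Fin 2) K) :
    ∃ H : MvPolynomial (Fin 3) K, H.IsHomogeneous (n * N + (N + k)) ∧
      localHom (b i) H - f ∈ originIdeal K ^ N ∧
      ∀ j ≠ i, localHom (b j) H ∈ originIdeal K ^ N := by
  have hL (j : Fin n) : ∃ L : MvPolynomial (Fin 3) K, L.IsHomogeneous 1 ∧
      eval (b i).rep L ≠ 0 ∧ (j ≠ i → eval (b j).rep L = 0) := by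
    by_cases hj : j = i
    · refine ⟨chartForm (b i), chartForm_isHomogeneous _, ?_, fun h => absurd hj h⟩
      rw [← constantCoeff_localHom, localHom_chartForm, map_one]
      exact one_ne_zero
    · obtain ⟨L, h1, h2, h3⟩ := exists_linear_form (hb.ne (Ne.symm hj))
      exact ⟨L, h1, h3, fun _ => h2⟩
  choose L hL1 hLi hLj using hL
  set M := ∏ j, L j ^ N
  have hM : M.IsHomogeneous (n * N) := by
    simpa using IsHomogeneous.prod Finset.univ (fun j => L j ^ N) (fun j => 1 * N)
      (fun j _ => (hL1 j).pow N)
  have hMi : localHom (b i) M ∉ originIdeal K := by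
    rw [RingHom.mem_ker, constantCoeff_localHom, map_prod, Finset.prod_eq_zero_iff]
    rintro ⟨j, -, hj⟩
    rw [map_pow] at hj
    exact hLi j (eq_zero_of_pow_eq_zero hj)
  -- `M` vanishes to order `N` at all other points but is a unit at `b i`; interpolating `t * f`
  -- instead of `f` compensates for this unit.
  obtain ⟨t, ht⟩ := exists_mul_sub_one_mem (N := N) le_rfl hMi
  obtain ⟨H, hH, hHf⟩ := exists_localHom_sub_mem (b i) (Nat.le_add_right N k) (t * f)
  refine ⟨M * H, hM.mul hH, ?_, fun j hj => ?_⟩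
  · rw [map_mul]
    have : localHom (b i) M * localHom (b i) H - f =
        localHom (b i) M * (localHom (b i) H - t * f) + f * (t * localHom (b i) M - 1) := by ring
    rw [this]
    exact add_mem (Ideal.mul_mem_left _ _ hHf) (Ideal.mul_mem_left _ _ ht)
  · rw [map_mul]
    refine Ideal.mul_mem_right _ _ ?_
    rw [map_prod]
    refine Ideal.mem_of_dvd _ (Finset.dvd_prod_of_mem _ (Finset.mem_univ j)) ?_
    rw [map_pow]
    refine Ideal.pow_mem_pow ?_ N
    rw [RingHom.mem_ker, constantCoeff_localHom, hLj j hj]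

/-- The local contributions of two cubic forms without common factor add up to at most nine. -/
theorem sum_finrank_quotient_le {F G : MvPolynomial (Fin 3) K} (h : IsCubicPencil F G) {n N : ℕ}
    {b : Fin n → ℙ K (Fin 3 → K)} (hb : Function.Injective b)
    (J : Fin n → Ideal (MvPolynomial (Fin 2) K)) (hJ : ∀ i, originIdeal K ^ N ≤ J i)
    (hF : ∀ i, localHom (b i) F ∈ J i) (hG : ∀ i, localHom (b i) G ∈ J i) :
    ∑ i, finrank K (MvPolynomial (Fin 2) K ⧸ J i) ≤ 9 := by
  classical
  have hfin (i : Fin n) := (finrank_quotient_add_finrank_map (hJ i)).1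
  set e := n * N + N
  let Φ : homogeneousSubmodule (Fin 3) K (e + 3 + 3) →ₗ[K]
      ((i : Fin n) → MvPolynomial (Fin 2) K ⧸ J i) :=
    LinearMap.pi fun i => (Ideal.Quotient.mkₐ K (J i)).toLinearMap ∘ₗ
      (localHom (b i)).toLinearMap ∘ₗ (homogeneousSubmodule (Fin 3) K (e + 3 + 3)).subtype
  have hΦ (x i) : Φ x i = Ideal.Quotient.mk (J i) (localHom (b i) x) := rfl
  have hsurj : Function.Surjective Φ := by
    rw [← LinearMap.range_eq_top, eq_top_iff]
    intro v _
    rw [← Finset.univ_sum_single v]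
    refine sum_mem fun i _ => ?_
    obtain ⟨f, hf⟩ := Ideal.Quotient.mk_surjective (v i)
    obtain ⟨H, hH, hHi, hHj⟩ := exists_interpolation hb N 6 i f
    refine ⟨⟨H, hH⟩, ?_⟩
    ext j
    rw [hΦ]
    by_cases hj : j = i
    · subst hj
      rw [Pi.single_eq_same, ← hf, Ideal.Quotient.eq]
      exact hJ j hHi
    · rw [Pi.single_eq_of_ne hj, Ideal.Quotient.eq_zero_iff_mem]
      exact hJ j (hHj j hj)
  have hle : LinearMap.range (syzygyMap h.left.2 h.right.2 (e + 3)) ≤ LinearMap.ker Φ := by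
    rintro _ ⟨x, rfl⟩
    rw [LinearMap.mem_ker]
    ext i
    rw [hΦ, coe_syzygyMap, Pi.zero_apply, Ideal.Quotient.eq_zero_iff_mem, map_add, map_mul,
      map_mul]
    exact add_mem (Ideal.mul_mem_left _ _ (hF i)) (Ideal.mul_mem_left _ _ (hG i))
  have h1 := LinearMap.finrank_range_add_finrank_ker Φ
  rw [LinearMap.range_eq_top.2 hsurj, finrank_top, finrank_pi_fintype] at h1
  have h2 := Submodule.finrank_mono hle
  have h3 := finrank_homogeneousSubmodule_le h e
  omega

end LocalEquation

/-! ### Intersection numbers with the general member of a local pencil -/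

section LocalPencil

variable {K : Type*} [Field K]

theorem eventually_sub_mul_ne_zero {a b : K} (h : ¬ (a = 0 ∧ b = 0)) :
    ∀ᶠ c in cofinite, a - c * b ≠ 0 := by
  rw [eventually_cofinite]
  refine Set.Subsingleton.finite fun c hc d hd => ?_
  simp only [ne_eq, not_not, Set.mem_ofPred_eq] at hc hd
  by_cases hb : b = 0
  · exact absurd ⟨by simpa [hb] using hc, hb⟩ h
  · apply mul_right_cancel₀ hb
    linear_combination hd - hc

theorem eventually_eval_homogeneousComponent_ne_zero {f g : MvPolynomial (Fin 2) K} {n : ℕ}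
    {P : Fin 2 → K}
    (h : ¬ (eval P (homogeneousComponent n f) = 0 ∧ eval P (homogeneousComponent n g) = 0)) :
    ∀ᶠ c : K in cofinite, eval P (homogeneousComponent n (f - c • g)) ≠ 0 := by
  filter_upwards [eventually_sub_mul_ne_zero h] with c hc
  simpa [smul_eval] using hc

theorem sub_smul_mem_originIdeal_pow {f g : MvPolynomial (Fin 2) K} {n : ℕ}
    (hf : f ∈ originIdeal K ^ n) (hg : g ∈ originIdeal K ^ n) (c : K) :
    f - c • g ∈ originIdeal K ^ n := by
  rw [smul_eq_C_mul]
  exact sub_mem hf (Ideal.mul_mem_left _ _ hg)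

/-- The homogeneous parts of degree `n` of `f` and `g` have no common root. -/
def NoCommonTangent (n : ℕ) (f g : MvPolynomial (Fin 2) K) : Prop :=
  ∀ P : Fin 2 → K, P ≠ 0 →
    ¬ (eval P (homogeneousComponent n f) = 0 ∧ eval P (homogeneousComponent n g) = 0)

theorem eventually_localLength_eq_one {q f g : MvPolynomial (Fin 2) K}
    (hq : q ∈ originIdeal K ^ 1) (hq1 : homogeneousComponent 1 q ≠ 0)
    (hf : f ∈ originIdeal K ^ 1) (hg : g ∈ originIdeal K ^ 1) (h : NoCommonTangent 1 f g) :
    ∀ᶠ c : K in cofinite, localLength q (f - c • g) = 1 := by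
  obtain ⟨P, hP, hqP⟩ := exists_eq_pointForm (homogeneousComponent_isHomogeneous 1 q) hq1
  filter_upwards [eventually_eval_homogeneousComponent_ne_zero (h P hP)] with c hc
  exact localLength_eq_one hq (sub_smul_mem_originIdeal_pow hf hg c) hP hqP hc

theorem eventually_localLength_eq_two {q f g : MvPolynomial (Fin 2) K}
    (hq : q ∈ originIdeal K ^ 1) (hq1 : homogeneousComponent 1 q ≠ 0)
    (hf : f ∈ originIdeal K ^ 2) (hg : g ∈ originIdeal K ^ 2) (h : NoCommonTangent 2 f g) :
    ∀ᶠ c : K in cofinite, localLength q (f - c • g) = 2 := by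
  obtain ⟨P, hP, hqP⟩ := exists_eq_pointForm (homogeneousComponent_isHomogeneous 1 q) hq1
  filter_upwards [eventually_eval_homogeneousComponent_ne_zero (h P hP)] with c hc
  exact localLength_eq_two hq (sub_smul_mem_originIdeal_pow hf hg c) hP hqP hc

theorem eventually_localLength_eq_four [IsAlgClosed K] {q f g : MvPolynomial (Fin 2) K}
    (hq : q ∈ originIdeal K ^ 2) (hq2 : homogeneousComponent 2 q ≠ 0)
    (hf : f ∈ originIdeal K ^ 2) (hg : g ∈ originIdeal K ^ 2) (h : NoCommonTangent 2 f g) :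
    ∀ᶠ c : K in cofinite, localLength q (f - c • g) = 4 := by
  obtain ⟨P, R, hP, hR, hqPR⟩ :=
    exists_eq_pointForm_mul_pointForm (homogeneousComponent_isHomogeneous 2 q) hq2
  filter_upwards [eventually_eval_homogeneousComponent_ne_zero (h P hP),
    eventually_eval_homogeneousComponent_ne_zero (h R hR)] with c hcP hcR
  exact localLength_eq_four hq (sub_smul_mem_originIdeal_pow hf hg c) hP hR hqPR hcP hcR

theorem localLength_sub_smul (q p : MvPolynomial (Fin 2) K) (a : K) :
    localLength q (p - a • q) = localLength q p := by
  rw [localLength, localLength, smul_eq_C_mul, map_sub, map_mul]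
  have h (R : Type _) [CommRing R] (x y z : R) :
      Ideal.span {x, y - z * x} = Ideal.span {x, y} := by
    rw [sub_eq_add_neg, ← neg_mul, Ideal.span_pair_add_mul_left]
  rw [h]

/-- Subtracting a multiple of `q` from a member of the pencil preserves the local ideal and removes
the linear part, so `localLength_eq_two` applies. -/
theorem eventually_localLength_eq_two_of_tangent {q f g : MvPolynomial (Fin 2) K}
    (hq : q ∈ originIdeal K ^ 1) {P : Fin 2 → K} (hP : P ≠ 0)
    (hqP : homogeneousComponent 1 q = pointForm P) {a b : K}
    (hf : f - a • q ∈ originIdeal K ^ 2) (hg : g - b • q ∈ originIdeal K ^ 2)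
    (h : ¬ (eval P (homogeneousComponent 2 (f - a • q)) = 0 ∧
      eval P (homogeneousComponent 2 (g - b • q)) = 0)) :
    ∀ᶠ c : K in cofinite, localLength q (f - c • g) = 2 := by
  filter_upwards [eventually_eval_homogeneousComponent_ne_zero h] with c hc
  rw [← localLength_eq_two hq (sub_smul_mem_originIdeal_pow hf hg c) hP hqP hc,
    ← localLength_sub_smul q (f - c • g) (a - c * b)]
  congr 1
  simp only [smul_eq_C_mul, C_sub, C_mul]
  ring

/-- The leading form of `f` is divisible by that of `q`, so a multiple of `q` cancels it and raises
the order by one. -/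
theorem mem_span_sup_originIdeal_pow {q f : MvPolynomial (Fin 2) K} {n : ℕ} {P : Fin 2 → K}
    (hP : P ≠ 0) (hq : q ∈ originIdeal K ^ 1) (hqP : homogeneousComponent 1 q = pointForm P)
    (hf : f ∈ originIdeal K ^ (n + 1)) (hfP : eval P (homogeneousComponent (n + 1) f) = 0) :
    f ∈ Ideal.span {q} ⊔ originIdeal K ^ (n + 2) := by
  obtain ⟨u, hu, hfu⟩ := exists_eq_pointForm_mul (homogeneousComponent_isHomogeneous (n + 1) f)
    hP hfP
  refine Submodule.mem_sup.2 ⟨u * q, Ideal.mem_span_singleton'.2 ⟨u, rfl⟩,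
    (f - homogeneousComponent (n + 1) f) - u * (q - homogeneousComponent 1 q), sub_mem
      (sub_homogeneousComponent_mem hf) (mul_mem_originIdeal_pow
        (mem_originIdeal_pow_of_isHomogeneous hu) (sub_homogeneousComponent_mem hq) le_rfl), ?_⟩
  rw [hqP, hfu]
  ring

end LocalPencil

/-! ### Restriction to a line -/

section Line

variable {K : Type*} [Field K]

/-- Restriction of a ternary form to the line through two points. -/
def lineHom (v w : Fin 3 → K) : MvPolynomial (Fin 3) K →ₐ[K] MvPolynomial (Fin 2) K :=
  aeval fun j => C (v j) * X 0 + C (w j) * X 1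

theorem lineHom_isHomogeneous {H : MvPolynomial (Fin 3) K} {d : ℕ} (hH : H.IsHomogeneous d)
    (v w : Fin 3 → K) : (lineHom v w H).IsHomogeneous d := by
  have := hH.aeval (fun j => C (v j) * X 0 + C (w j) * X 1 : Fin 3 → MvPolynomial (Fin 2) K)
    (n := 1) fun j => (isHomogeneous_C_mul_X _ _).add (isHomogeneous_C_mul_X _ _)
  rwa [one_mul] at this

theorem eval_lineHom (v w : Fin 3 → K) (s t : K) (H : MvPolynomial (Fin 3) K) :
    eval ![s, t] (lineHom v w H) = eval (s • v + t • w) H := by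
  rw [lineHom, ← aeval_eq_eval, ← aeval_eq_eval, ← AlgHom.comp_apply, comp_aeval]
  congr 2
  ext j
  simp [mul_comm]

theorem X_pow_dvd_aeval_of_mem {f : MvPolynomial (Fin 2) K} {n : ℕ}
    (hf : f ∈ originIdeal K ^ n) (z : Fin 2 → PowerSeries K) :
    PowerSeries.X ^ n ∣ aeval (fun k => PowerSeries.X * z k) f := by
  rw [← Ideal.mem_span_singleton, ← Ideal.span_singleton_pow]
  set θ : MvPolynomial (Fin 2) K →ₐ[K] PowerSeries K := aeval fun k => PowerSeries.X * z k
  have h1 : (originIdeal K).map θ ≤ Ideal.span {PowerSeries.X} := by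
    rw [originIdeal_eq_idealOfVars, Ideal.map_span, Ideal.span_le]
    rintro _ ⟨_, ⟨k, rfl⟩, rfl⟩
    simp only [θ, aeval_X, SetLike.mem_coe]
    exact Ideal.mul_mem_right _ _ (Ideal.mem_span_singleton_self _)
  have h2 := Ideal.mem_map_of_mem θ hf
  rw [Ideal.map_pow] at h2
  exact Ideal.pow_right_mono h1 n h2

/-- Dividing the point `p + w * X` of the line by the unit `U` moves it into the affine chart at
`p`, where its displacement from `p` is `X * z`. Homogeneity turns this rescaling into the harmless
factor `U ^ d`. -/
theorem X_pow_dvd_of_localHom_mem {H : MvPolynomial (Fin 3) K} {d n : ℕ}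
    (hH : H.IsHomogeneous d) {p : ℙ K (Fin 3 → K)} (hp : localHom p H ∈ originIdeal K ^ n)
    (w : Fin 3 → K) :
    PowerSeries.X ^ n ∣
      aeval (fun j => PowerSeries.C (p.rep j) + PowerSeries.C (w j) * PowerSeries.X) H := by
  set i := chartIndex p
  have hi : p.rep i ≠ 0 := rep_chartIndex_ne_zero p
  set U : PowerSeries K := 1 + PowerSeries.C (w i / p.rep i) * PowerSeries.X
  obtain ⟨V, hV⟩ : ∃ V, U * V = 1 :=
    ⟨U⁻¹, PowerSeries.mul_inv_cancel U (by simp [U])⟩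
  set z : Fin 2 → PowerSeries K := fun k =>
    V * (PowerSeries.C (w (i.succAbove k)) -
      PowerSeries.C (w i / p.rep i) * PowerSeries.C (p.rep (i.succAbove k)))
  have h1 : (fun j => PowerSeries.C (p.rep j) + PowerSeries.C (w j) * PowerSeries.X) =
      fun j => U * (V * (PowerSeries.C (p.rep j) + PowerSeries.C (w j) * PowerSeries.X)) := by
    ext1 j
    rw [← mul_assoc, hV, one_mul]
  have h2 : aeval (fun j => V * (PowerSeries.C (p.rep j) + PowerSeries.C (w j) * PowerSeries.X)) =
      (aeval (fun k => PowerSeries.X * z k)).comp (localHom p) := by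
    ext1 j
    rw [aeval_X, AlgHom.comp_apply]
    refine Fin.succAboveCases i ?_ (fun k => ?_) j
    · rw [localHom_X_chartIndex, ← algebraMap_eq, AlgHom.commutes]
      have h3 : PowerSeries.C (w i) = PowerSeries.C (w i / p.rep i) * PowerSeries.C (p.rep i) := by
        rw [← map_mul, div_mul_cancel₀ _ hi]
      change _ = PowerSeries.C (p.rep i)
      rw [h3]
      linear_combination PowerSeries.C (p.rep i) * hV
    · rw [localHom_X_succAbove, map_add, aeval_X, ← algebraMap_eq, AlgHom.commutes]
      change _ = PowerSeries.C (p.rep (i.succAbove k)) + _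
      simp only [z]
      linear_combination PowerSeries.C (p.rep (i.succAbove k)) * hV
  rw [h1, aeval_mul_of_isHomogeneous hH, h2, AlgHom.comp_apply]
  exact Dvd.dvd.mul_left (X_pow_dvd_aeval_of_mem hp z) _

theorem X_pow_dvd_lineHom_left {H : MvPolynomial (Fin 3) K} {d n : ℕ}
    (hH : H.IsHomogeneous d) {p : ℙ K (Fin 3 → K)} (hp : localHom p H ∈ originIdeal K ^ n)
    (w : Fin 3 → K) :
    PowerSeries.X ^ n ∣ aeval ![1, (PowerSeries.X : PowerSeries K)] (lineHom p.rep w H) := by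
  convert X_pow_dvd_of_localHom_mem hH hp w using 1
  rw [lineHom, ← AlgHom.comp_apply, comp_aeval]
  congr 2
  ext1 j
  simp only [map_add, map_mul, aeval_X, ← algebraMap_eq, AlgHom.commutes]
  simp

theorem X_pow_dvd_lineHom_right {H : MvPolynomial (Fin 3) K} {d n : ℕ}
    (hH : H.IsHomogeneous d) {p : ℙ K (Fin 3 → K)} (hp : localHom p H ∈ originIdeal K ^ n)
    (w : Fin 3 → K) :
    PowerSeries.X ^ n ∣ aeval ![(PowerSeries.X : PowerSeries K), 1] (lineHom w p.rep H) := by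
  convert X_pow_dvd_of_localHom_mem hH hp w using 1
  rw [lineHom, ← AlgHom.comp_apply, comp_aeval]
  congr 2
  ext1 j
  simp only [map_add, map_mul, aeval_X, ← algebraMap_eq, AlgHom.commutes]
  simp [add_comm]

/-- A cubic form that is singular at two points vanishes on the line joining them. -/
theorem lineHom_eq_zero_of_cubic {H : MvPolynomial (Fin 3) K} (hH : H.IsHomogeneous 3)
    {p q : ℙ K (Fin 3 → K)} (hp : localHom p H ∈ originIdeal K ^ 2)
    (hq : localHom q H ∈ originIdeal K ^ 2) : lineHom p.rep q.rep H = 0 := by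
  obtain ⟨a, b, c, d, h⟩ := exists_eq_of_isHomogeneous_three (lineHom_isHomogeneous hH p.rep q.rep)
  have h1 := X_pow_dvd_lineHom_left hH hp q.rep
  have h2 := X_pow_dvd_lineHom_right hH hq p.rep
  rw [h, PowerSeries.X_pow_dvd_iff] at h1 h2
  -- A double zero at either end of the line kills two of the four coefficients each.
  have e1 := h1 0 (by norm_num)
  have e2 := h1 1 (by norm_num)
  have e3 := h2 0 (by norm_num)
  have e4 := h2 1 (by norm_num)
  simp [PowerSeries.coeff_X_pow] at e1 e2 e3 e4
  rw [h, e1, e2, e3, e4]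
  simp

/-- A conic that is singular at one point of a line and passes through another contains it. -/
theorem lineHom_eq_zero_of_conic {H : MvPolynomial (Fin 3) K} (hH : H.IsHomogeneous 2)
    {p q : ℙ K (Fin 3 → K)} (hp : localHom p H ∈ originIdeal K ^ 2)
    (hq : localHom q H ∈ originIdeal K ^ 1) : lineHom p.rep q.rep H = 0 := by
  obtain ⟨a, b, c, h⟩ := exists_eq_of_isHomogeneous_two (lineHom_isHomogeneous hH p.rep q.rep)
  have h1 := X_pow_dvd_lineHom_left hH hp q.rep
  have h2 := X_pow_dvd_lineHom_right hH hq p.rep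
  rw [h, PowerSeries.X_pow_dvd_iff] at h1 h2
  have e1 := h1 0 (by norm_num)
  have e2 := h1 1 (by norm_num)
  have e3 := h2 0 (by norm_num)
  simp [PowerSeries.coeff_X_pow] at e1 e2 e3
  rw [h, e1, e2, e3]
  simp

theorem onCurve_mk {H : MvPolynomial (Fin 3) K} {d : ℕ} (hH : H.IsHomogeneous d)
    {v : Fin 3 → K} (hv : v ≠ 0) (h : eval v H = 0) : OnCurve H (Projectivization.mk K v hv) := by
  obtain ⟨a, ha⟩ := Projectivization.exists_smul_eq_mk_rep K v hv
  rw [OnCurve, ← ha, Units.smul_def, eval_smul_of_isHomogeneous hH, h, mul_zero]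

theorem infinite_basePoints_of_lineHom_eq_zero [Infinite K] {F G : MvPolynomial (Fin 3) K}
    (hFG : IsCubicPencil F G) {p q : ℙ K (Fin 3 → K)} (hpq : p ≠ q)
    (hF : lineHom p.rep q.rep F = 0) (hG : lineHom p.rep q.rep G = 0) :
    (basePoints F G).Infinite := by
  have hli : LinearIndependent K ![p.rep, q.rep] :=
    Projectivization.linearIndependent_pair_iff_ne.2 hpq
  rw [LinearIndependent.pair_iff] at hli
  have hv (t : K) : p.rep + t • q.rep ≠ 0 := fun h =>
    one_ne_zero (hli 1 t (by rwa [one_smul])).1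
  let γ : K → ℙ K (Fin 3 → K) := fun t => Projectivization.mk K _ (hv t)
  have hγ : Function.Injective γ := by
    intro s t hst
    obtain ⟨a, ha⟩ := (Projectivization.mk_eq_mk_iff' K _ _ (hv s) (hv t)).1 hst
    have := hli (a - 1) (a * t - s) (by
      have : (a - 1) • p.rep + (a * t - s) • q.rep =
          a • (p.rep + t • q.rep) - (p.rep + s • q.rep) := by module
      rw [this, ha, sub_self])
    have ha1 : a = 1 := sub_eq_zero.1 this.1
    have h2 := this.2
    rw [ha1, one_mul] at h2
    exact (sub_eq_zero.1 h2).symm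
  refine (Set.infinite_range_of_injective hγ).mono ?_
  rintro _ ⟨t, rfl⟩
  have h (H : MvPolynomial (Fin 3) K) (hH : lineHom p.rep q.rep H = 0) :
      eval (p.rep + t • q.rep) H = 0 := by
    have := eval_lineHom p.rep q.rep 1 t H
    rwa [hH, map_zero, one_smul, eq_comm] at this
  exact ⟨onCurve_mk hFG.left.2 _ (h F hF), onCurve_mk hFG.right.2 _ (h G hG)⟩

end Line

/-! ### Cubic pencils with a double base-point and a tangent base-point -/

section Pencil

variable {K : Type*} [Field K]

/-- If local contributions adding up to nine are known, they are maximal. -/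
theorem finrank_quotient_le_of_sum_eq_nine {F G : MvPolynomial (Fin 3) K}
    (h : IsCubicPencil F G) {n N : ℕ} {b : Fin n → ℙ K (Fin 3 → K)} (hb : Function.Injective b)
    (D : Fin n → Ideal (MvPolynomial (Fin 2) K)) (hD : ∀ i, originIdeal K ^ N ≤ D i)
    (hF : ∀ i, localHom (b i) F ∈ D i) (hG : ∀ i, localHom (b i) G ∈ D i) (m : Fin n → ℕ)
    (hm : ∀ i, m i ≤ finrank K (MvPolynomial (Fin 2) K ⧸ D i)) (hsum : ∑ i, m i = 9)
    (i : Fin n) {J : Ideal (MvPolynomial (Fin 2) K)} (hJ : originIdeal K ^ N ≤ J)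
    (hFJ : localHom (b i) F ∈ J) (hGJ : localHom (b i) G ∈ J) :
    finrank K (MvPolynomial (Fin 2) K ⧸ J) ≤ m i := by
  classical
  have hJ' (P : Fin n → Ideal (MvPolynomial (Fin 2) K) → Prop) (h1 : ∀ j, P j (D j))
      (h2 : P i J) (j) : P j (Function.update D i J j) := by
    by_cases hj : j = i
    · subst hj; simpa
    · simpa [hj] using h1 j
  -- Only the ideal at `b i` is exchanged; the others still contribute at least `9 - m i`.
  have key := sum_finrank_quotient_le h hb (Function.update D i J)
    (hJ' (fun _ I => originIdeal K ^ N ≤ I) hD hJ)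
    (hJ' (fun j I => localHom (b j) F ∈ I) hF hFJ)
    (hJ' (fun j I => localHom (b j) G ∈ I) hG hGJ)
  rw [← Finset.add_sum_erase _ _ (Finset.mem_univ i)] at key hsum
  have hle : ∑ j ∈ Finset.univ.erase i, m j ≤ ∑ j ∈ Finset.univ.erase i,
      finrank K (MvPolynomial (Fin 2) K ⧸ Function.update D i J j) := by
    refine Finset.sum_le_sum fun j hj => ?_
    rw [Function.update_of_ne (Finset.ne_of_mem_erase hj)]
    exact hm j
  rw [Function.update_self] at key
  omega

/-- A further base-point would contribute at least one more, giving a total of ten. -/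
theorem basePoints_eq_range_of_sum_eq_nine {F G : MvPolynomial (Fin 3) K}
    (h : IsCubicPencil F G) {n N : ℕ} {b : Fin n → ℙ K (Fin 3 → K)} (hb : Function.Injective b)
    (hbF : ∀ i, b i ∈ basePoints F G)
    (D : Fin n → Ideal (MvPolynomial (Fin 2) K)) (hN : 1 ≤ N) (hD : ∀ i, originIdeal K ^ N ≤ D i)
    (hF : ∀ i, localHom (b i) F ∈ D i) (hG : ∀ i, localHom (b i) G ∈ D i) (m : Fin n → ℕ)
    (hm : ∀ i, m i ≤ finrank K (MvPolynomial (Fin 2) K ⧸ D i)) (hsum : ∑ i, m i = 9) :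
    basePoints F G = Set.range b := by
  refine Set.Subset.antisymm (fun p hp => ?_) (by rintro _ ⟨i, rfl⟩; exact hbF i)
  by_contra hpb
  have key := sum_finrank_quotient_le h (b := Fin.cons p b)
    (Fin.cons_injective_iff.2 ⟨hpb, hb⟩) (N := N) (Fin.cons (originIdeal K ^ 1) D)
    (Fin.cases (Ideal.pow_le_pow_right hN) hD) (Fin.cases (onCurve_iff.1 hp.1) hF)
    (Fin.cases (onCurve_iff.1 hp.2) hG)
  rw [Fin.sum_univ_succ] at key
  change finrank K (MvPolynomial (Fin 2) K ⧸ originIdeal K ^ 1) +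
    ∑ i, finrank K (MvPolynomial (Fin 2) K ⧸ D i) ≤ 9 at key
  have h1 := one_le_finrank_quotient (K := K)
  have h2 := (add_le_add h1 (Finset.sum_le_sum fun i (_ : i ∈ Finset.univ) => hm i)).trans key
  rw [hsum] at h2
  omega

theorem isTangentLine_iff {T F : MvPolynomial (Fin 3) K} {p : ℙ K (Fin 3 → K)} :
    IsTangentLine T F p ↔ OnCurve T p ∧ OnCurve F p ∧
      ∃ c : K, homogeneousComponent 1 (localHom p F) =
        c • homogeneousComponent 1 (localHom p T) :=
  Iff.rfl

theorem localHom_pencilMember (F G : MvPolynomial (Fin 3) K) (c : K) (p : ℙ K (Fin 3 → K)) :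
    localHom p (pencilMember F G c) = localHom p F - c • localHom p G := by
  rw [pencilMember, map_sub, map_smul]

theorem localHom_mem_of_baseMultiplicity_eq {F G : MvPolynomial (Fin 3) K}
    {p : ℙ K (Fin 3 → K)} {n : ℕ} (h : baseMultiplicity F G p = n) :
    localHom p F ∈ originIdeal K ^ n ∧ localHom p G ∈ originIdeal K ^ n := by
  rw [← le_multiplicity_iff, ← le_multiplicity_iff, ← le_min_iff]
  exact h.ge

/-- A curve with the tangent line of `Q` at a simple point of `Q` has there the local equation of
`Q` up to a factor and terms of higher order. -/
theorem exists_sub_smul_mem {T Q H : MvPolynomial (Fin 3) K} {p : ℙ K (Fin 3 → K)}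
    (hQ : multiplicity Q p = 1) (hTQ : IsTangentLine T Q p) (hTH : IsTangentLine T H p) :
    ∃ a : K, localHom p H - a • localHom p Q ∈ originIdeal K ^ 2 := by
  obtain ⟨-, hQp, c, hc⟩ := isTangentLine_iff.1 hTQ
  obtain ⟨-, hHp, d, hd⟩ := isTangentLine_iff.1 hTH
  have hQ1 := (multiplicity_eq_iff (n := 1).1 (by exact_mod_cast hQ)).2
  have hc0 : c ≠ 0 := by
    rintro rfl
    exact hQ1 (by rw [hc, zero_smul])
  refine ⟨d / c, ?_⟩
  rw [← homogeneousComponent_eq_zero_iff_mem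
    (sub_smul_mem_originIdeal_pow (onCurve_iff.1 hHp) (onCurve_iff.1 hQp) _), map_sub, map_smul,
    hc, hd, smul_smul, div_mul_cancel₀ _ hc0, sub_self]

/-- The configuration of base-points, with a curve `Q` tangent to the pencil at `b 1`. -/
structure TangentConfiguration (F G Q : MvPolynomial (Fin 3) K)
    (b : Fin 5 → ℙ K (Fin 3 → K)) : Prop where
  injective : Function.Injective b
  pencil : IsCubicPencil F G
  double : baseMultiplicity F G (b 0) = 2
  simple : ∀ i, i ≠ 0 → baseMultiplicity F G (b i) = 1
  multiplicity_one : multiplicity Q (b 1) = 1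
  tangent_left : ∃ a : K, localHom (b 1) F - a • localHom (b 1) Q ∈ originIdeal K ^ 2
  tangent_right : ∃ a : K, localHom (b 1) G - a • localHom (b 1) Q ∈ originIdeal K ^ 2

namespace TangentConfiguration

variable {F G Q : MvPolynomial (Fin 3) K} {b : Fin 5 → ℙ K (Fin 3 → K)}

theorem mem_double (h : TangentConfiguration F G Q b) :
    localHom (b 0) F ∈ originIdeal K ^ 2 ∧ localHom (b 0) G ∈ originIdeal K ^ 2 :=
  localHom_mem_of_baseMultiplicity_eq h.double

theorem mem_simple (h : TangentConfiguration F G Q b) {i : Fin 5} (hi : i ≠ 0) :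
    localHom (b i) F ∈ originIdeal K ^ 1 ∧ localHom (b i) G ∈ originIdeal K ^ 1 :=
  localHom_mem_of_baseMultiplicity_eq (by exact_mod_cast h.simple i hi)

theorem mem_tangent (h : TangentConfiguration F G Q b) :
    localHom (b 1) Q ∈ originIdeal K ^ 1 ∧ homogeneousComponent 1 (localHom (b 1) Q) ≠ 0 :=
  multiplicity_eq_iff.1 (by exact_mod_cast h.multiplicity_one)

/-- Ideals accounting for the full intersection of two members of the pencil. -/
theorem exists_ideals (h : TangentConfiguration F G Q b) :
    ∃ (D : Fin 5 → Ideal (MvPolynomial (Fin 2) K)), (∀ i, originIdeal K ^ 4 ≤ D i) ∧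
      (∀ i, localHom (b i) F ∈ D i) ∧ (∀ i, localHom (b i) G ∈ D i) ∧
      ∀ i, ![4, 2, 1, 1, 1] i ≤ finrank K (MvPolynomial (Fin 2) K ⧸ D i) := by
  have hpow {n : ℕ} (hn : n ≤ 4) : originIdeal K ^ 4 ≤ originIdeal K ^ n :=
    Ideal.pow_le_pow_right hn
  have htan {H : MvPolynomial (Fin 3) K}
      (hH : ∃ a : K, localHom (b 1) H - a • localHom (b 1) Q ∈ originIdeal K ^ 2) :
      localHom (b 1) H ∈ Ideal.span {localHom (b 1) Q} ⊔ originIdeal K ^ 2 := by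
    obtain ⟨a, ha⟩ := hH
    exact Submodule.mem_sup.2 ⟨a • localHom (b 1) Q, Ideal.mem_span_singleton'.2
      ⟨C a, (smul_eq_C_mul _ _).symm⟩, _, ha, by ring⟩
  -- The common exponent 4 exceeds what these ideals need; it leaves room for the comparison ideal
  -- at `b 0` in `noCommonTangent_double`.
  refine ⟨![Ideal.span {localHom (b 0) F, localHom (b 0) G} ⊔ originIdeal K ^ 3,
    Ideal.span {localHom (b 1) Q} ⊔ originIdeal K ^ 2,
    originIdeal K ^ 1, originIdeal K ^ 1, originIdeal K ^ 1], fun i => ?_, fun i => ?_,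
    fun i => ?_, fun i => ?_⟩
  · fin_cases i
    exacts [le_sup_of_le_right (hpow (by norm_num)), le_sup_of_le_right (hpow (by norm_num)),
      hpow (by norm_num), hpow (by norm_num), hpow (by norm_num)]
  · fin_cases i
    exacts [Ideal.mem_sup_left (Ideal.subset_span (by simp)), htan h.tangent_left,
      (h.mem_simple (by decide)).1, (h.mem_simple (by decide)).1, (h.mem_simple (by decide)).1]
  · fin_cases i
    exacts [Ideal.mem_sup_left (Ideal.subset_span (by simp)), htan h.tangent_right,
      (h.mem_simple (by decide)).2, (h.mem_simple (by decide)).2, (h.mem_simple (by decide)).2]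
  · fin_cases i
    exacts [four_le_finrank_quotient h.mem_double.1 h.mem_double.2,
      two_le_finrank_quotient h.mem_tangent.1, one_le_finrank_quotient, one_le_finrank_quotient,
      one_le_finrank_quotient]

theorem basePoints_eq (h : TangentConfiguration F G Q b) : basePoints F G = Set.range b := by
  obtain ⟨D, hD, hF, hG, hm⟩ := h.exists_ideals
  refine basePoints_eq_range_of_sum_eq_nine h.pencil h.injective (fun i => ?_) D (by norm_num) hD
    hF hG _ hm (by decide)
  by_cases hi : i = 0
  · subst hi
    exact ⟨onCurve_iff.2 (Ideal.pow_le_pow_right one_le_two h.mem_double.1),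
      onCurve_iff.2 (Ideal.pow_le_pow_right one_le_two h.mem_double.2)⟩
  · exact ⟨onCurve_iff.2 (h.mem_simple hi).1, onCurve_iff.2 (h.mem_simple hi).2⟩

theorem finrank_quotient_le (h : TangentConfiguration F G Q b) (i : Fin 5)
    {J : Ideal (MvPolynomial (Fin 2) K)} (hJ : originIdeal K ^ 4 ≤ J)
    (hF : localHom (b i) F ∈ J) (hG : localHom (b i) G ∈ J) :
    finrank K (MvPolynomial (Fin 2) K ⧸ J) ≤ ![4, 2, 1, 1, 1] i := by
  obtain ⟨D, hD, hF', hG', hm⟩ := h.exists_ideals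
  exact finrank_quotient_le_of_sum_eq_nine h.pencil h.injective D hD hF' hG' _ hm (by decide) i hJ
    hF hG

/-- A common root would raise the contribution of `b 0` to at least five, where only four is left.
-/
theorem noCommonTangent_double (h : TangentConfiguration F G Q b) :
    NoCommonTangent 2 (localHom (b 0) F) (localHom (b 0) G) := by
  rintro P hP ⟨hF, hG⟩
  have h1 := five_le_finrank_quotient h.mem_double.1 h.mem_double.2 hP hF hG
  have h2 := h.finrank_quotient_le 0 (J := Ideal.span {localHom (b 0) F, localHom (b 0) G} ⊔
    originIdeal K ^ 4) le_sup_right (Ideal.mem_sup_left (Ideal.subset_span (by simp)))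
    (Ideal.mem_sup_left (Ideal.subset_span (by simp)))
  exact absurd (h1.trans h2) (by decide)

/-- A common tangent would put both equations into an ideal of colength at least two, where only one
is left. -/
theorem noCommonTangent_simple (h : TangentConfiguration F G Q b) {i : Fin 5}
    (hi : i ∈ ({2, 3, 4} : Set (Fin 5))) :
    NoCommonTangent 1 (localHom (b i) F) (localHom (b i) G) := by
  rintro P hP ⟨hF, hG⟩
  have hi0 : i ≠ 0 := by
    rintro rfl
    simp at hi
  have hl := mem_originIdeal_pow_of_isHomogeneous (pointForm_isHomogeneous P)
  have hl1 : homogeneousComponent 1 (pointForm P) = pointForm P :=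
    homogeneousComponent_eq_self (pointForm_isHomogeneous P)
  have h1 := two_le_finrank_quotient hl
  have h2 := h.finrank_quotient_le i (J := Ideal.span {pointForm P} ⊔ originIdeal K ^ 2)
    (le_sup_of_le_right (Ideal.pow_le_pow_right (by norm_num)))
    (mem_span_sup_originIdeal_pow hP hl hl1 (h.mem_simple hi0).1 hF)
    (mem_span_sup_originIdeal_pow hP hl hl1 (h.mem_simple hi0).2 hG)
  have h3 := h1.trans h2
  rcases hi with rfl | rfl | rfl <;> exact absurd h3 (by decide)

theorem eventually_intersectionNumber_tangent (h : TangentConfiguration F G Q b) :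
    ∀ᶠ c : K in cofinite, intersectionNumber Q (pencilMember F G c) (b 1) = 2 := by
  obtain ⟨α, hα⟩ := h.tangent_left
  obtain ⟨β, hβ⟩ := h.tangent_right
  obtain ⟨hq, hq1⟩ := h.mem_tangent
  obtain ⟨P, hP, hqP⟩ :=
    exists_eq_pointForm (homogeneousComponent_isHomogeneous 1 (localHom (b 1) Q)) hq1
  simp only [intersectionNumber_eq, localHom_pencilMember]
  refine eventually_localLength_eq_two_of_tangent hq hP hqP hα hβ ?_
  -- Otherwise `F` and `G` both lie in `(q) + m ^ 3`, of colength at least three, where only two is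
  -- left.
  rintro ⟨hF, hG⟩
  have hmem {f : MvPolynomial (Fin 2) K} {a : K} (hf : f - a • localHom (b 1) Q ∈ originIdeal K ^ 2)
      (hfP : eval P (homogeneousComponent 2 (f - a • localHom (b 1) Q)) = 0) :
      f ∈ Ideal.span {localHom (b 1) Q} ⊔ originIdeal K ^ 3 := by
    have h1 := mem_span_sup_originIdeal_pow hP hq hqP hf hfP
    have h2 : a • localHom (b 1) Q ∈ Ideal.span {localHom (b 1) Q} ⊔ originIdeal K ^ 3 :=
      Ideal.mem_sup_left (Ideal.mem_span_singleton'.2 ⟨C a, (smul_eq_C_mul _ _).symm⟩)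
    simpa using add_mem h1 h2
  have h1 := three_le_finrank_quotient hq
  have h2 := h.finrank_quotient_le 1 (J := Ideal.span {localHom (b 1) Q} ⊔ originIdeal K ^ 3)
    (le_sup_of_le_right (Ideal.pow_le_pow_right (by norm_num))) (hmem hα hF) (hmem hβ hG)
  exact absurd (h1.trans h2) (by decide)

theorem eventually_intersectionNumber_simple (h : TangentConfiguration F G Q b) {i : Fin 5}
    (hi : i ∈ ({2, 3, 4} : Set (Fin 5))) (hQ : multiplicity Q (b i) = 1) :
    ∀ᶠ c : K in cofinite, intersectionNumber Q (pencilMember F G c) (b i) = 1 := by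
  have hi0 : i ≠ 0 := by
    rintro rfl
    simp at hi
  obtain ⟨hq, hq1⟩ := multiplicity_eq_iff (n := 1).1 (by exact_mod_cast hQ)
  simp only [intersectionNumber_eq, localHom_pencilMember]
  exact eventually_localLength_eq_one hq hq1 (h.mem_simple hi0).1 (h.mem_simple hi0).2
    (h.noCommonTangent_simple hi)

theorem intersectionNumber_eq_zero {p : ℙ K (Fin 3 → K)} (hQ : ¬ OnCurve Q p)
    (H : MvPolynomial (Fin 3) K) : intersectionNumber Q H p = 0 := by
  rw [intersectionNumber_eq]
  refine localLength_eq_zero ?_ _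
  rwa [onCurve_iff, pow_one] at hQ

theorem eventually_intersectionNumber_double [IsAlgClosed K] (h : TangentConfiguration F G Q b)
    (hQ : multiplicity Q (b 0) = 2) :
    ∀ᶠ c : K in cofinite, intersectionNumber Q (pencilMember F G c) (b 0) = 4 := by
  obtain ⟨hq, hq2⟩ := multiplicity_eq_iff (n := 2).1 (by exact_mod_cast hQ)
  simp only [intersectionNumber_eq, localHom_pencilMember]
  exact eventually_localLength_eq_four hq hq2 h.mem_double.1 h.mem_double.2
    h.noCommonTangent_double

/-- A conic of the configuration is not singular at the double base-point, as otherwise the line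
joining `b 0` and `b 1` would be a component of all curves of the pencil. -/
theorem homogeneousComponent_one_ne_zero [Infinite K] (h : TangentConfiguration F G Q b)
    (hQ : Q.IsHomogeneous 2) (hQ0 : localHom (b 0) Q ∈ originIdeal K ^ 1) :
    homogeneousComponent 1 (localHom (b 0) Q) ≠ 0 := by
  intro hq
  rw [homogeneousComponent_eq_zero_iff_mem hQ0] at hq
  have hQline := lineHom_eq_zero_of_conic hQ hq h.mem_tangent.1
  have hline {H : MvPolynomial (Fin 3) K} (hH : H.IsHomogeneous 3)
      (hH0 : localHom (b 0) H ∈ originIdeal K ^ 2)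
      (hH1 : ∃ a : K, localHom (b 1) H - a • localHom (b 1) Q ∈ originIdeal K ^ 2) :
      lineHom (b 0).rep (b 1).rep H = 0 := by
    obtain ⟨a, ha⟩ := hH1
    -- The factor `chartForm (b 1)` raises `Q` to a cubic without changing its local equation at `b
    -- 1`. The difference with `H` is singular at `b 1` by tangency, and at `b 0` because `H` and
    -- `Q` both are.
    have hR : (C a * chartForm (b 1) * Q).IsHomogeneous 3 :=
      ((chartForm_isHomogeneous (b 1)).C_mul a).mul hQ
    have := lineHom_eq_zero_of_cubic (H := H - C a * chartForm (b 1) * Q) (hH.sub hR)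
      (p := b 0) (q := b 1) ?_ ?_
    · rwa [map_sub, map_mul, hQline, mul_zero, sub_zero] at this
    · rw [map_sub, map_mul]
      exact sub_mem hH0 (Ideal.mul_mem_left _ _ hq)
    · rwa [map_sub, map_mul, map_mul, localHom_chartForm, localHom_C, mul_one, ← smul_eq_C_mul]
  refine infinite_basePoints_of_lineHom_eq_zero h.pencil
    (h.injective.ne (show (0 : Fin 5) ≠ 1 by decide))
    (hline h.pencil.left.2 h.mem_double.1 h.tangent_left)
    (hline h.pencil.right.2 h.mem_double.2 h.tangent_right) ?_
  rw [h.basePoints_eq]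
  exact Set.finite_range b

theorem eventually_intersectionNumber_conic [Infinite K] (h : TangentConfiguration F G Q b)
    (hQ : Q.IsHomogeneous 2) (hQ0 : OnCurve Q (b 0)) :
    ∀ᶠ c : K in cofinite, intersectionNumber Q (pencilMember F G c) (b 0) = 2 := by
  have hq := onCurve_iff.1 hQ0
  simp only [intersectionNumber_eq, localHom_pencilMember]
  exact eventually_localLength_eq_two hq (h.homogeneousComponent_one_ne_zero hQ hq)
    h.mem_double.1 h.mem_double.2 h.noCommonTangent_double

theorem isInvolutionCurve (h : TangentConfiguration F G Q b)
    (hsum : ∀ᶠ c : K in cofinite, ∑ i, intersectionNumber Q (pencilMember F G c) (b i) + 1 =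
      3 * (Q.totalDegree : ℕ∞)) : IsInvolutionCurve F G Q := by
  refine ⟨h.basePoints_eq ▸ Set.finite_range b, ?_⟩
  refine (eventually_cofinite.1 hsum).subset fun c hc => ?_
  rw [h.basePoints_eq] at hc
  change (∑ᶠ p ∈ Set.range b, _) + 1 ≠ _ at hc
  rwa [finsum_mem_range h.injective, finsum_eq_sum_of_fintype] at hc

end TangentConfiguration

end Pencil

end PlanePencil

end

open PlanePencil Filter in
theorem proposition1 {K : Type*} [Field K] [IsAlgClosed K]
    (F G T Q : MvPolynomial (Fin 3) K) (b : Fin 5 → ℙ K (Fin 3 → K))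
    (hb : Function.Injective b)
    (hP : PlanePencil.IsCubicPencil F G)
    (hdouble : PlanePencil.baseMultiplicity F G (b 0) = 2)
    (hsimple : ∀ i, i ≠ 0 → PlanePencil.baseMultiplicity F G (b i) = 1)
    (hT : PlanePencil.IsPlaneCurve T 1)
    (htangent : ∀ c : K,
      PlanePencil.IsTangentLine T (PlanePencil.pencilMember F G c) (b 1))
    (hQtangent : PlanePencil.multiplicity Q (b 1) = 1 ∧ PlanePencil.IsTangentLine T Q (b 1))
    (hQ :
      (PlanePencil.IsPlaneCurve Q 2 ∧ PlanePencil.OnCurve Q (b 0) ∧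
        ∃ i ∈ ({2, 3, 4} : Set (Fin 5)), PlanePencil.multiplicity Q (b i) = 1 ∧
          ∀ k ∈ ({2, 3, 4} : Set (Fin 5)), k ≠ i → ¬ PlanePencil.OnCurve Q (b k)) ∨
      (PlanePencil.IsPlaneCurve Q 3 ∧ PlanePencil.multiplicity Q (b 0) = 2 ∧
        ∃ i ∈ ({2, 3, 4} : Set (Fin 5)), ∃ j ∈ ({2, 3, 4} : Set (Fin 5)), i ≠ j ∧
          PlanePencil.multiplicity Q (b i) = 1 ∧ PlanePencil.multiplicity Q (b j) = 1 ∧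
          ∀ k ∈ ({2, 3, 4} : Set (Fin 5)), k ≠ i → k ≠ j → ¬ PlanePencil.OnCurve Q (b k))) :
    PlanePencil.IsInvolutionCurve F G Q := by
  have : Infinite K := IsAlgClosed.instInfinite
  have hcfg : TangentConfiguration F G Q b := by
    -- Tangency is assumed for the members `F - c G` only; `c = 0` and `c = 1` give `F` and `F - G`,
    -- and their difference gives `G`.
    obtain ⟨α, hα⟩ := exists_sub_smul_mem hQtangent.1 hQtangent.2 (htangent 0)
    obtain ⟨β, hβ⟩ := exists_sub_smul_mem hQtangent.1 hQtangent.2 (htangent 1)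
    rw [localHom_pencilMember, zero_smul, sub_zero] at hα
    rw [localHom_pencilMember, one_smul] at hβ
    refine ⟨hb, hP, hdouble, hsimple, hQtangent.1, ⟨α, hα⟩, ⟨α - β, ?_⟩⟩
    have h := sub_mem hα hβ
    convert h using 1
    rw [sub_smul]
    ring
  apply hcfg.isInvolutionCurve
  rcases hQ with ⟨hQ, hQ0, i, hi, hQi, hoff⟩ | ⟨hQ, hQ0, i, hi, j, hj, hij, hQi, hQj, hoff⟩
  · filter_upwards [hcfg.eventually_intersectionNumber_conic hQ.2 hQ0,
      hcfg.eventually_intersectionNumber_tangent,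
      hcfg.eventually_intersectionNumber_simple hi hQi] with c h0 h1 hci
    have hz (k) (hk : k ∈ ({2, 3, 4} : Set (Fin 5))) (hki : k ≠ i) :
        intersectionNumber Q (pencilMember F G c) (b k) = 0 :=
      TangentConfiguration.intersectionNumber_eq_zero (hoff k hk hki) _
    rw [hQ.2.totalDegree hQ.1, Fin.sum_univ_five, h0, h1]
    rcases hi with rfl | rfl | rfl
    · rw [hci, hz 3 (by simp) (by decide), hz 4 (by simp) (by decide)]
      rfl
    · rw [hci, hz 2 (by simp) (by decide), hz 4 (by simp) (by decide)]
      rfl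
    · rw [hci, hz 2 (by simp) (by decide), hz 3 (by simp) (by decide)]
      rfl
  · filter_upwards [hcfg.eventually_intersectionNumber_double hQ0,
      hcfg.eventually_intersectionNumber_tangent,
      hcfg.eventually_intersectionNumber_simple hi hQi,
      hcfg.eventually_intersectionNumber_simple hj hQj] with c h0 h1 hci hcj
    have hz (k) (hk : k ∈ ({2, 3, 4} : Set (Fin 5))) (hki : k ≠ i) (hkj : k ≠ j) :
        intersectionNumber Q (pencilMember F G c) (b k) = 0 :=
      TangentConfiguration.intersectionNumber_eq_zero (hoff k hk hki hkj) _
    rw [hQ.2.totalDegree hQ.1, Fin.sum_univ_five, h0, h1]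
    rcases hi with rfl | rfl | rfl <;> rcases hj with rfl | rfl | rfl
    · exact absurd rfl hij
    · rw [hci, hcj, hz 4 (by simp) (by decide) (by decide)]
      rfl
    · rw [hci, hcj, hz 3 (by simp) (by decide) (by decide)]
      rfl
    · rw [hci, hcj, hz 4 (by simp) (by decide) (by decide)]
      rfl
    · exact absurd rfl hij
    · rw [hci, hcj, hz 2 (by simp) (by decide) (by decide)]
      rfl
    · rw [hci, hcj, hz 3 (by simp) (by decide) (by decide)]
      rfl
    · rw [hci, hcj, hz 2 (by simp) (by decide) (by decide)]
      rfl
    · exact absurd rfl hij
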